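/- Maps and morphisms are composed from left to right, and all categories are small. **Consistent categories.** A *category with subobjects* is a category $\mathcal C$ with a wide subcategory $\mathcal P$ of *inclusions* which is a strict preorder, consists of monomorphisms of $\mathcal C$, and is such that $g,hg\in\mathcal P$ implies $h\in\mathcal P$. Write $a\subseteq b$ if there is an inclusion $j_a^b\colon a\to b$. A *retraction* is a morphism $q$ with $jq=1$ for some inclusion $j$; a *bimorphism* is a monomorphism that is an epimorphism. A *consistent* (resp. *normal*) *factorisation* of $f$ is $f=qwj$ with $q$ a retraction, $w$ a bimorphism (resp. an isomorphism) and $j$ an inclusion. The *epimorphic component* $f^\circ=qw$ of a consistent factorisation and its codomain $\operatorname{im}f$ depend only on $f$. Let $\langle c\rangle$ be the category whose objects are the subobjects of $c$ and whose morphisms are generated by the inclusions and retractions between them. A bimorphism $w\colon c\to d$ is *consistent* if there is a unique isomorphism of categories $T\colon\langle c\rangle\to\langle d\rangle$ with $T(a)=\operatorname{im}(j_a^cw)$, preserving inclusions, for which the morphisms $(j_a^cw)^\circ\colon a\to T(a)$ are natural in $a\in\langle c\rangle$. A *consistent cone* $\gamma$ with vertex $c_\gamma$ is a family of morphisms $\gamma(a)\colon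 a\to c_\gamma$, one for each object $a$, with $j_a^b\gamma(b)=\gamma(a)$ whenever $a\subseteq b$, at least one of which is a bimorphism. $\mathcal C$ is a *consistent category* if inclusions have right inverses, every morphism has a consistent factorisation, every bimorphism is consistent, every morphism $jq$ with $j$ an inclusion and $q$ a retraction has a normal factorisation, and each object $c$ is the vertex of a consistent cone $\epsilon$ with $\epsilon(c)=1_c$. An *isomorphism of consistent categories* is a functor between consistent categories that is bijective on objects and on morphisms and preserves and reflects inclusions. **Duals.** Let $\mathcal C$ be consistent. For a consistent cone $\gamma$ and a morphism $f$ from $c_\gamma$, let $\gamma\ast f^\circ$ be the cone $a\mapsto\gamma(a)f^\circ$. The consistent cones form a semigroup under $\gamma\cdot\gamma'=\gamma\ast(\gamma'(c_\gamma))^\circ$. For an idempotent cone $\epsilon$ let $H(\epsilon;-)\colon\mathcal C\to\mathbf{Set}$ be the functor with $H(\epsilon;c)=\{\epsilon\ast f^\circ: f\in\mathcal C(c_\epsilon,c)\}$ and $H(\epsilon;g)\colon\epsilon\ast f^\circ\mapsto\epsilon\ast(fg)^\circ$, and let $MH(\epsilon;-)=\{c:\epsilon(c)\text{ is an isomorphism}\}$;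 for each $c\in MH(\epsilon;-)$ there is a unique idempotent cone $\xi$ with vertex $c$ and $H(\xi;-)=H(\epsilon;-)$. The *dual* $\mathcal C^*$ is the full subcategory of $[\mathcal C,\mathbf{Set}]$ on these functors, its inclusions being the natural transformations whose components are inclusions of sets. A *local isomorphism* is a fully faithful functor $F$ that preserves inclusions and restricts to isomorphisms $\langle c\rangle\to\langle F(c)\rangle$ for all $c$. **Cross-connections.** Let $\mathcal C,\mathcal D$ be consistent categories. Let $\Gamma\colon\mathcal D\to\mathcal C^*$ and $\Delta\colon\mathcal C\to\mathcal D^*$ be local isomorphisms such that $c\in M\Gamma(d)\iff d\in M\Delta(c)$ for all $c,d$. Put $E_\Omega=\{(c,d):c\in M\Gamma(d)\}$; for $(c,d)\in E_\Omega$ let $\gamma(c,d)$ be the idempotent cone of $\mathcal C$ with vertex $c$ and $H(\gamma(c,d);-)=\Gamma(d)$, and $\delta(c,d)$ the idempotent cone of $\mathcal D$ with vertex $d$ and $H(\delta(c,d);-)=\Delta(c)$. For $(c',d),(c,d')\in E_\Omega$, the *transpose through $\Delta$* of $f\colon c'\to c$ is the unique $g\colon d'\to d$ such that $\Delta(f)$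 maps $\delta(c',d)\ast k^\circ$ to $\delta(c,d')\ast(gk)^\circ$ for all morphisms $k$ from $d$; the *transpose through $\Gamma$* of $g\colon d'\to d$ is the unique $f\colon c'\to c$ such that $\Gamma(g)$ maps $\gamma(c,d')\ast k^\circ$ to $\gamma(c',d)\ast(fk)^\circ$ for all morphisms $k$ from $c$. Then $\Omega=(\Gamma,\Delta;\mathcal C,\mathcal D)$ is a *cross-connection* if moreover $\Delta$ is dual to $\Gamma$, that is: $g$ is the transpose of $f$ through $\Delta$ if and only if $f$ is the transpose of $g$ through $\Gamma$; and for $(c,d),(a,b)\in E_\Omega$ the transpose through $\Delta$ of $\gamma(a,b)(c)\colon c\to a$ is $\delta(c,d)(b)\colon b\to d$. Cones $\gamma$ of $\mathcal C$ and $\delta$ of $\mathcal D$ are *linked* if $\gamma=\gamma(c',d)\ast f^\circ$ and $\delta=\delta(c,d')\ast g^\circ$ for some $(c',d),(c,d')\in E_\Omega$ and $f\colon c'\to c$ with transpose $g\colon d'\to d$ through $\Delta$. Let $\mathbb S\Omega$ be the set of linked pairs $(\gamma,\delta)$, with the operation $(\gamma,\delta)(\gamma',\delta')=(\gamma\cdot\gamma',\delta'\cdot\delta)$.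 For a semigroup $S$, the objects of $\mathbb L(S)$ are the left ideals $Se$ ($e$ idempotent), its morphisms $Se\to Sf$ are the maps $\rho(e,u,f)\colon x\mapsto xu$ with $u\in eSf$, and its inclusions are the inclusions of sets. Dually, $\mathbb R(S)$ has objects $eS$ and morphisms $\lambda(e,u,f)\colon eS\to fS$, $x\mapsto ux$, with $u\in fSe$. **Theorem.** Let $\mathcal C$ and $\mathcal D$ be consistent categories. 1. Every local isomorphism $\Gamma\colon\mathcal D\to\mathcal C^*$ such that each object $c$ of $\mathcal C$ lies in $M\Gamma(d)$ for some $d$ belongs to exactly one cross-connection $(\Gamma,\Delta;\mathcal C,\mathcal D)$. 2. Let $\Omega=(\Gamma,\Delta;\mathcal C,\mathcal D)$ be a cross-connection. Each $c$ is in $M\Gamma(d)$ for some $d$, and each $M\Gamma(d)$ is nonempty. $\mathbb S\Omega$ is a semigroup. There is exactly one functor $F_\Omega\colon\mathcal C\to\mathbb L(\mathbb S\Omega)$ such that, for all $f\colon c\to c'$ and all $(c,d),(c',d')\in E_\Omega$, $$F_\Omega(c)=\mathbb S\Omega\,e,\qquad F_\Omega(f)=\rho\bigl(e,\,(\gamma(c,d)\ast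 f^\circ,\ \delta(c',d')\ast g^\circ),\,e'\bigr),$$ where $e=(\gamma(c,d),\delta(c,d))$, $e'=(\gamma(c',d'),\delta(c',d'))$ and $g\colon d'\to d$ is the transpose of $f$ through $\Delta$. There is exactly one functor $G_\Omega\colon\mathcal D\to\mathbb R(\mathbb S\Omega)$ such that, for all $g\colon d\to d'$ and all $(c,d),(c',d')\in E_\Omega$, with the same $e,e'$, $$G_\Omega(d)=e\,\mathbb S\Omega,\qquad G_\Omega(g)=\lambda\bigl(e,\,(\gamma(c',d')\ast f^\circ,\ \delta(c,d)\ast g^\circ),\,e'\bigr),$$ where $f\colon c'\to c$ is the morphism whose transpose through $\Delta$ is $g$. Both $F_\Omega$ and $G_\Omega$ are isomorphisms of consistent categories; in particular $\mathbb L(\mathbb S\Omega)$ and $\mathbb R(\mathbb S\Omega)$ are consistent categories. -/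

import Mathlib

open CategoryTheory

-- With this instance, `a ⟶ b` would not be read through the category structure.
attribute [-instance] CategoryTheory.catToReflQuiver

universe u

namespace CrossConn

/-! ## Categories with subobjects and consistent categories -/

/-- A category together with a subcategory of distinguished morphisms, the *inclusions*, which is
wide and a strict preorder, consists of monomorphisms, and contains `h` as soon as it contains `g`
and `h ≫ g`. -/
class CategoryWithSubobjects (C : Type u) [SmallCategory C] where
  incl : MorphismProperty C
  incl_id : ∀ a : C, incl (𝟙 a)
  incl_comp : ∀ {a b c : C} (f : a ⟶ b) (g : b ⟶ c), incl f → incl g → incl (f ≫ g)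
  incl_thin : ∀ {a b : C} (f g : a ⟶ b), incl f → incl g → f = g
  incl_strict : ∀ {a b : C} (f : a ⟶ b) (g : b ⟶ a), incl f → incl g → a = b
  incl_mono : ∀ {a b : C} (f : a ⟶ b), incl f → Mono f
  incl_of_comp : ∀ {a b c : C} (h : a ⟶ b) (g : b ⟶ c), incl g → incl (h ≫ g) → incl h

section Subobjects

variable {C : Type u} [SmallCategory C] [CategoryWithSubobjects C]

/-- The morphism `f` is an inclusion. -/
def IsIncl {a b : C} (f : a ⟶ b) : Prop := CategoryWithSubobjects.incl f

/-- `a ⊆ b`: there is an inclusion from `a` to `b`. -/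
def Sub (a b : C) : Prop := ∃ j : a ⟶ b, IsIncl j

/-- The inclusion of `a` in `b`. -/
noncomputable def Sub.hom {a b : C} (h : Sub a b) : a ⟶ b := h.choose

theorem Sub.isIncl {a b : C} (h : Sub a b) : IsIncl h.hom := h.choose_spec

theorem Sub.refl (a : C) : Sub a a := ⟨𝟙 a, CategoryWithSubobjects.incl_id a⟩

/-- A retraction is a right inverse (in diagrammatic order) of an inclusion. -/
def IsRetraction {a b : C} (q : a ⟶ b) : Prop := ∃ j : b ⟶ a, IsIncl j ∧ j ≫ q = 𝟙 b

theorem IsRetraction.epi {a b : C} {q : a ⟶ b} (h : IsRetraction q) : Epi q := by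
  obtain ⟨j, -, hj⟩ := h
  exact ⟨fun f g e => by simpa [← Category.assoc, hj] using congrArg (j ≫ ·) e⟩

/-- A bimorphism: a monomorphism that is an epimorphism. -/
def IsBimorphism {a b : C} (u : a ⟶ b) : Prop := Mono u ∧ Epi u

/-- `p` is the epimorphic component `q ≫ w` and `j` the inclusion of a consistent factorisation
`f = q ≫ w ≫ j` (`q` a retraction, `w` a bimorphism, `j` an inclusion). Thus `p = f°` and `m` is
the image of `f`. -/
def IsEpiComponent {a b m : C} (f : a ⟶ b) (p : a ⟶ m) (j : m ⟶ b) : Prop :=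
  IsIncl j ∧ f = p ≫ j ∧
    ∃ (k : C) (q : a ⟶ k) (w : k ⟶ m), IsRetraction q ∧ IsBimorphism w ∧ p = q ≫ w

theorem IsEpiComponent.epi {a b m : C} {f : a ⟶ b} {p : a ⟶ m} {j : m ⟶ b}
    (h : IsEpiComponent f p j) : Epi p := by
  obtain ⟨-, -, k, q, w, hq, hw, rfl⟩ := h
  have := hq.epi
  have := hw.2
  exact epi_comp q w

/-- `f` has a normal factorisation: retraction, isomorphism, inclusion. -/
def HasNormalFactorisation {a b : C} (f : a ⟶ b) : Prop :=
  ∃ (k m : C) (q : a ⟶ k) (w : k ⟶ m) (j : m ⟶ b),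
    IsRetraction q ∧ IsIso w ∧ IsIncl j ∧ f = q ≫ w ≫ j

/-- The morphisms generated by the inclusions and the retractions between subobjects of `c`. -/
inductive Core (c : C) : ∀ {a b : C}, (a ⟶ b) → Prop
  | incl {a b : C} (f : a ⟶ b) : Sub a c → Sub b c → IsIncl f → Core c f
  | retr {a b : C} (f : a ⟶ b) : Sub a c → Sub b c → IsRetraction f → Core c f
  | comp {a b d : C} (f : a ⟶ b) (g : b ⟶ d) : Core c f → Core c g → Core c (f ≫ g)

/-- The objects of the category `⟨c⟩`: the subobjects of `c`. -/
structure CoreIdeal (c : C) where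
  obj : C
  sub : Sub obj c

/-- The category `⟨c⟩`: its objects are the subobjects of `c`, its morphisms are generated by the
inclusions and the retractions between subobjects of `c`. -/
instance (c : C) : Category.{u} (CoreIdeal c) where
  Hom a b := {f : a.obj ⟶ b.obj // Core c f}
  id a := ⟨𝟙 a.obj, .incl _ a.sub a.sub (CategoryWithSubobjects.incl_id _)⟩
  comp f g := ⟨f.1 ≫ g.1, .comp _ _ f.2 g.2⟩
  id_comp _ := Subtype.ext (Category.id_comp _)
  comp_id _ := Subtype.ext (Category.comp_id _)
  assoc _ _ _ := Subtype.ext (Category.assoc _ _ _)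

end Subobjects

/-- An isomorphism of categories: a functor that is bijective on objects and on morphisms. -/
def IsCatIso {A B : Type u} [SmallCategory A] [SmallCategory B] (F : A ⥤ B) : Prop :=
  Function.Bijective F.obj ∧ ∀ a b : A, Function.Bijective (F.map : (a ⟶ b) → (F.obj a ⟶ F.obj b))

section Consistent

variable {C : Type u} [SmallCategory C] [CategoryWithSubobjects C]

/-- `T : ⟨c⟩ ⥤ ⟨d⟩` is an isomorphism which extends `T^w : σ(c) → σ(d)`, given by
`T^w a = im (j_a^c ≫ w)` on objects and by inclusions on inclusions, and the morphisms
`(j_a^c ≫ w)° : a ⟶ T a` are natural in `a ∈ ⟨c⟩`. -/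
def IsConnectingFunctor {c d : C} (w : c ⟶ d) (T : CoreIdeal c ⥤ CoreIdeal d) : Prop :=
  IsCatIso T ∧
  (∀ (a b : CoreIdeal c) (f : a ⟶ b), IsIncl f.1 → IsIncl (T.map f).1) ∧
  ∃ p : ∀ a : CoreIdeal c, a.obj ⟶ (T.obj a).obj,
    (∀ a : CoreIdeal c, IsEpiComponent (a.sub.hom ≫ w) (p a) (T.obj a).sub.hom) ∧
    ∀ (a b : CoreIdeal c) (f : a ⟶ b), f.1 ≫ p b = p a ≫ (T.map f).1

/-- A consistent bimorphism. -/
def IsConsistentBimorphism {c d : C} (w : c ⟶ d) : Prop :=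
  IsBimorphism w ∧ ∃! T : CoreIdeal c ⥤ CoreIdeal d, IsConnectingFunctor w T

variable (C) in
/-- A consistent cone: a vertex and a component `a ⟶ vertex` for each object `a`, compatible with
inclusions, at least one component being a bimorphism. -/
@[ext]
structure Cone where
  vertex : C
  component : ∀ a : C, a ⟶ vertex
  compat : ∀ {a b : C} (j : a ⟶ b), IsIncl j → j ≫ component b = component a
  exists_bimorphism : ∃ a : C, IsBimorphism (component a)

end Consistent

/-- A consistent category: a category with subobjects satisfying the remaining axioms. -/
class ConsistentCategory (C : Type u) [SmallCategory C] [CategoryWithSubobjects C] : Prop where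
  /-- Every inclusion splits. -/
  split : ∀ {a b : C} (j : a ⟶ b), IsIncl j → ∃ q : b ⟶ a, j ≫ q = 𝟙 a
  /-- Every morphism has a consistent factorisation. -/
  factor : ∀ {a b : C} (f : a ⟶ b), ∃ (m : C) (p : a ⟶ m) (j : m ⟶ b), IsEpiComponent f p j
  /-- Every bimorphism is consistent. -/
  consistent : ∀ {c d : C} (w : c ⟶ d), IsBimorphism w → IsConsistentBimorphism w
  /-- An inclusion followed by a retraction has a normal factorisation. -/
  normal : ∀ {a b c : C} (j : a ⟶ b) (q : b ⟶ c), IsIncl j → IsRetraction q →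
    HasNormalFactorisation (j ≫ q)
  /-- Each object `c` is the vertex of a consistent cone whose component at `c` is the identity. -/
  cone : ∀ c : C, ∃ (ε : Cone C) (h : ε.vertex = c), ε.component c ≫ eqToHom h = 𝟙 c

/-! ## Epimorphic components and the semigroup of consistent cones -/

section Cones

variable {C : Type u} [SmallCategory C] [CategoryWithSubobjects C] [ConsistentCategory C]

/-- The image of `f`. -/
noncomputable def im {a b : C} (f : a ⟶ b) : C := (ConsistentCategory.factor f).choose

/-- The epimorphic component `f°` of `f`. -/
noncomputable def epiPart {a b : C} (f : a ⟶ b) : a ⟶ im f :=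
  (ConsistentCategory.factor f).choose_spec.choose

/-- The inclusion of the image of `f` in the codomain of `f`. -/
noncomputable def imIncl {a b : C} (f : a ⟶ b) : im f ⟶ b :=
  (ConsistentCategory.factor f).choose_spec.choose_spec.choose

theorem epiPart_spec {a b : C} (f : a ⟶ b) : IsEpiComponent f (epiPart f) (imIncl f) :=
  (ConsistentCategory.factor f).choose_spec.choose_spec.choose_spec

instance {a b : C} (f : a ⟶ b) : Epi (epiPart f) := (epiPart_spec f).epi

theorem imIncl_isIncl {a b : C} (f : a ⟶ b) : IsIncl (imIncl f) := (epiPart_spec f).1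

theorem epiPart_comp {a b : C} (f : a ⟶ b) : epiPart f ≫ imIncl f = f :=
  (epiPart_spec f).2.1.symm

theorem incl_factor {a b m n : C} {p : a ⟶ m} {j : m ⟶ b} {p' : a ⟶ n} {j' : n ⟶ b}
    [Epi p] (hj : IsIncl j) (hj' : IsIncl j') (h : p ≫ j = p' ≫ j') :
    ∃ i : m ⟶ n, IsIncl i ∧ i ≫ j' = j := by
  obtain ⟨r, hr⟩ := ConsistentCategory.split j' hj'
  have key : (j ≫ r) ≫ j' = j := by
    rw [← cancel_epi p]
    calc p ≫ (j ≫ r) ≫ j' = (p ≫ j) ≫ r ≫ j' := by simp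
      _ = p' ≫ (j' ≫ r) ≫ j' := by rw [h]; simp
      _ = p ≫ j := by rw [hr, h]; simp
  refine ⟨j ≫ r, CategoryWithSubobjects.incl_of_comp _ j' hj' ?_, key⟩
  rw [key]
  exact hj

/-- Uniqueness of the factorisation of a morphism as an epimorphism followed by an inclusion. -/
theorem epi_incl_unique {a b m n : C} {p : a ⟶ m} {j : m ⟶ b} {p' : a ⟶ n} {j' : n ⟶ b}
    [Epi p] [Epi p'] (hj : IsIncl j) (hj' : IsIncl j') (h : p ≫ j = p' ≫ j') :
    ∃ e : m = n, p ≫ eqToHom e = p' := by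
  obtain ⟨i, hi, hij⟩ := incl_factor hj hj' h
  obtain ⟨i', hi', -⟩ := incl_factor hj' hj h.symm
  obtain rfl := CategoryWithSubobjects.incl_strict i i' hi hi'
  have hjj : j = j' := CategoryWithSubobjects.incl_thin _ _ hj hj'
  subst hjj
  have := CategoryWithSubobjects.incl_mono j hj
  exact ⟨rfl, by simpa [cancel_mono] using h⟩

/-- The cone `γ ∗ f`, for an epimorphism `f` from the vertex of `γ`. -/
def Cone.star (γ : Cone C) {d : C} (f : γ.vertex ⟶ d) [Epi f] : Cone C where
  vertex := d
  component a := γ.component a ≫ f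
  compat j hj := by rw [← Category.assoc, γ.compat j hj]
  exists_bimorphism := by
    obtain ⟨c, hm, he⟩ := γ.exists_bimorphism
    obtain ⟨m, p, j, hj, hf, k, q, w, ⟨i, hi, hiq⟩, ⟨hwm, hwe⟩, hp⟩ :=
      ConsistentCategory.factor (γ.component c ≫ f)
    have hepi : Epi (γ.component c ≫ f) := epi_comp _ _
    have hje : Epi j := by
      rw [hf] at hepi
      exact epi_of_epi p j
    have hjm : Mono j := CategoryWithSubobjects.incl_mono j hj
    have : γ.component k ≫ f = w ≫ j := by
      rw [← γ.compat i hi, Category.assoc, hf, hp, Category.assoc, ← Category.assoc, hiq,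
        Category.id_comp]
    exact ⟨k, by rw [this]; exact ⟨mono_comp w j, epi_comp w j⟩⟩

theorem Cone.star_congr (γ : Cone C) {m n : C} (p : γ.vertex ⟶ m) (p' : γ.vertex ⟶ n)
    [Epi p] [Epi p'] (e : m = n) (h : p ≫ eqToHom e = p') : γ.star p = γ.star p' := by
  subst e
  obtain rfl : p = p' := by simpa using h
  rfl

/-- `γ ∗ f°`, for a morphism `f` from the vertex of `γ`. -/
noncomputable def Cone.act (γ : Cone C) {d : C} (f : γ.vertex ⟶ d) : Cone C := γ.star (epiPart f)

theorem Cone.act_eq_star (γ : Cone C) {m d : C} {f : γ.vertex ⟶ d} (p : γ.vertex ⟶ m) (j : m ⟶ d)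
    [Epi p] (hj : IsIncl j) (h : p ≫ j = f) : γ.act f = γ.star p := by
  obtain ⟨e, he⟩ := epi_incl_unique (p := epiPart f) (p' := p) (imIncl_isIncl f) hj
    (by rw [epiPart_comp, h])
  exact γ.star_congr _ _ e he

theorem Cone.star_act (γ : Cone C) {m d : C} (p : γ.vertex ⟶ m) [Epi p] (f : m ⟶ d) :
    (γ.star p).act f = γ.act (p ≫ f) := by
  have : Epi (p ≫ epiPart f) := epi_comp _ _
  rw [γ.act_eq_star (p ≫ epiPart f) (imIncl f) (imIncl_isIncl f)
    (by rw [Category.assoc, epiPart_comp])]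
  simp only [Cone.act, Cone.star, Category.assoc]

/-- Composing with an inclusion does not change the epimorphic component. -/
theorem Cone.act_comp_incl (γ : Cone C) {b d : C} (f : γ.vertex ⟶ b) (j : b ⟶ d) (hj : IsIncl j) :
    γ.act (f ≫ j) = γ.act f :=
  γ.act_eq_star (epiPart f) (imIncl f ≫ j)
    (CategoryWithSubobjects.incl_comp _ _ (imIncl_isIncl f) hj)
    (by rw [← Category.assoc, epiPart_comp])

/-- `(γ ∗ f°) ∗ (j ≫ g)° = γ ∗ (f ≫ g)°`, where `j` is the inclusion of the image of `f`. -/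
theorem Cone.act_act (γ : Cone C) {b d : C} (f : γ.vertex ⟶ b) (g : b ⟶ d) :
    (γ.act f).act (imIncl f ≫ g : im f ⟶ d) = γ.act (f ≫ g) := by
  have h := γ.star_act (epiPart f) (imIncl f ≫ g)
  rw [← Category.assoc, epiPart_comp] at h
  exact h

theorem Cone.act_act_of_sub (γ : Cone C) {b d : C} (f : γ.vertex ⟶ b) (g : b ⟶ d)
    (h : Sub (γ.act f).vertex b) : (γ.act f).act (h.hom ≫ g) = γ.act (f ≫ g) := by
  have e : h.hom = imIncl f := CategoryWithSubobjects.incl_thin _ _ h.isIncl (imIncl_isIncl f)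
  rw [e]
  exact γ.act_act f g

/-- The product `γ₁ · γ₂ = γ₁ ∗ (γ₂ (c_{γ₁}))°` of consistent cones. -/
noncomputable instance : Mul (Cone C) := ⟨fun γ₁ γ₂ => γ₁.act (γ₂.component γ₁.vertex)⟩

theorem Cone.mul_def (γ₁ γ₂ : Cone C) : γ₁ * γ₂ = γ₁.act (γ₂.component γ₁.vertex) := rfl

noncomputable instance : Semigroup (Cone C) where
  mul_assoc γ₁ γ₂ γ₃ := by
    have h₁ : γ₁ * γ₂ * γ₃ =
        γ₁.act (epiPart (γ₂.component γ₁.vertex) ≫ γ₃.component (im (γ₂.component γ₁.vertex))) :=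
      γ₁.star_act _ _
    have h₂ : γ₁ * (γ₂ * γ₃) =
        γ₁.act (γ₂.component γ₁.vertex ≫ epiPart (γ₃.component γ₂.vertex)) := rfl
    have h₃ : epiPart (γ₂.component γ₁.vertex) ≫ γ₃.component (im (γ₂.component γ₁.vertex)) =
        (γ₂.component γ₁.vertex ≫ epiPart (γ₃.component γ₂.vertex)) ≫
          imIncl (γ₃.component γ₂.vertex) := by
      rw [← γ₃.compat (imIncl (γ₂.component γ₁.vertex)) (imIncl_isIncl _), ← Category.assoc,
        epiPart_comp, Category.assoc, epiPart_comp]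
    rw [h₁, h₂, h₃]
    exact γ₁.act_comp_incl _ _ (imIncl_isIncl _)

/-- `γ ∗ f°`, where the domain `c` of `f` is equal to the vertex of `γ`. -/
noncomputable def Cone.push (γ : Cone C) {c d : C} (h : γ.vertex = c) (f : c ⟶ d) : Cone C :=
  γ.act (eqToHom h ≫ f)

/-! ## H-functors and the consistent dual -/

variable (C) in
/-- The functor that takes `c` to the set of consistent cones whose vertex is a subobject of `c`
and `g : c ⟶ d` to the map `γ ↦ γ ∗ (j ≫ g)°`, where `j` is the inclusion of the vertex of `γ`
in `c`. -/
noncomputable def coneFunctor : C ⥤ Type u where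
  obj c := {γ : Cone C // Sub γ.vertex c}
  map g := TypeCat.ofHom fun γ => ⟨γ.1.act (γ.2.hom ≫ g), imIncl _, imIncl_isIncl _⟩
  map_id c := by
    refine ConcreteCategory.hom_ext _ _ fun γ => Subtype.ext ?_
    change γ.1.act (γ.2.hom ≫ 𝟙 c) = γ.1
    rw [Category.comp_id, γ.1.act_eq_star (𝟙 _) γ.2.hom γ.2.isIncl (Category.id_comp _)]
    refine Cone.ext rfl (heq_of_eq ?_)
    funext a
    exact Category.comp_id _
  map_comp {c d e} g h := by
    refine ConcreteCategory.hom_ext _ _ fun γ => Subtype.ext ?_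
    change γ.1.act (γ.2.hom ≫ g ≫ h) = (γ.1.act (γ.2.hom ≫ g)).act (Sub.hom _ ≫ h)
    rw [Cone.act_act_of_sub, Category.assoc]

/-- The H-functor `H(ε;-)`, with `H(ε;c) = {ε ∗ f° : f ∈ C(c_ε, c)}`. -/
noncomputable def H (ε : Cone C) : Subfunctor (coneFunctor C) where
  obj c := {γ | ∃ f : ε.vertex ⟶ c, γ.1 = ε.act f}
  map := by
    rintro c d g ⟨γ, hγ⟩ ⟨f, rfl : γ = ε.act f⟩
    refine ⟨f ≫ g, ?_⟩
    exact ε.act_act_of_sub f g _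

/-- `H(ε;g)` is the map `ε ∗ f° ↦ ε ∗ (f ≫ g)°`. -/
theorem H_map (ε : Cone C) {c d : C} (g : c ⟶ d) (f : ε.vertex ⟶ c)
    (x : (H ε).toFunctor.obj c) (hx : x.1.1 = ε.act f) :
    ((H ε).toFunctor.map g x).1.1 = ε.act (f ≫ g) := by
  obtain ⟨⟨γ, hγ⟩, h⟩ := x
  obtain rfl : γ = ε.act f := hx
  exact ε.act_act_of_sub f g _

variable (C) in
/-- The objects of the consistent dual `C*`: the H-functors of the idempotent consistent cones. -/
structure Dual where
  functor : Subfunctor (coneFunctor C)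
  exists_cone : ∃ ε : Cone C, IsIdempotentElem ε ∧ functor = H ε

/-- `C*` is a full subcategory of the category of functors from `C` to sets. -/
noncomputable instance : SmallCategory (Dual C) where
  Hom A B := A.functor.toFunctor ⟶ B.functor.toFunctor
  id A := 𝟙 A.functor.toFunctor
  comp f g := NatTrans.vcomp f g
  id_comp f := Category.id_comp (X := _) f
  comp_id f := Category.comp_id (X := _) f
  assoc f g h := Category.assoc (W := _) f g h

/-- The cone `τ x`, for a morphism `τ : A ⟶ B` of `C*` and an element `x` of `A(c)`. -/
def Dual.apply {A B : Dual C} (τ : A ⟶ B) {c : C} (x : A.functor.toFunctor.obj c) :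
    B.functor.toFunctor.obj c :=
  (show A.functor.toFunctor ⟶ B.functor.toFunctor from τ).app c x

theorem Dual.hom_ext {A B : Dual C} (σ τ : A ⟶ B)
    (h : ∀ (c : C) (x : A.functor.toFunctor.obj c), (Dual.apply σ x).1.1 = (Dual.apply τ x).1.1) :
    σ = τ :=
  NatTrans.ext (by
    funext c
    ext x
    exact Subtype.ext (Subtype.ext (h c x)))

/-- The inclusions of `C*` are the natural transformations all of whose components are inclusions
of sets. -/
noncomputable instance : CategoryWithSubobjects (Dual C) where
  incl A B τ := ∀ (c : C) (x : A.functor.toFunctor.obj c), (Dual.apply τ x).1.1 = x.1.1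
  incl_id _ _ _ := rfl
  incl_comp f g hf hg c x := (hg c (Dual.apply f x)).trans (hf c x)
  incl_thin f g hf hg := Dual.hom_ext f g fun c x => (hf c x).trans (hg c x).symm
  incl_strict {A B} f g hf hg := by
    have le : ∀ {A B : Dual C} (f : A ⟶ B),
        (∀ (c : C) (x : A.functor.toFunctor.obj c), (Dual.apply f x).1.1 = x.1.1) →
        A.functor ≤ B.functor := by
      intro A B f hf c x hx
      have h1 := (Dual.apply f (⟨x, hx⟩ : A.functor.toFunctor.obj c)).2
      have h2 : (Dual.apply f (⟨x, hx⟩ : A.functor.toFunctor.obj c)).1 = x :=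
        Subtype.ext (hf c ⟨x, hx⟩)
      rw [h2] at h1
      exact h1
    have h := le_antisymm (le f hf) (le g hg)
    obtain ⟨FA, hA⟩ := A
    obtain ⟨FB, hB⟩ := B
    obtain rfl : FA = FB := h
    rfl
  incl_mono {A B} f hf := ⟨fun {Z} g h e => Dual.hom_ext g h fun c x => by
    have e' : Dual.apply f (Dual.apply g x) = Dual.apply f (Dual.apply h x) :=
      congrArg (fun t : Z ⟶ B => Dual.apply t x) e
    rw [← hf c (Dual.apply g x), e', hf]⟩
  incl_of_comp h g hg hhg c x := (hg c (Dual.apply h x)).symm.trans (hhg c x)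

/-- The M-set of an H-functor `H(ε;-)`: the objects at which the component of `ε` is an
isomorphism. -/
def Dual.mSet (A : Dual C) : Set C :=
  {c | ∃ ε : Cone C, IsIdempotentElem ε ∧ A.functor = H ε ∧ IsIso (ε.component c)}

end Cones

/-! ## Cross-connections -/

section LocalIso

variable {A B : Type u} [SmallCategory A] [SmallCategory B]
  [CategoryWithSubobjects A] [CategoryWithSubobjects B]

/-- A local isomorphism: a functor that preserves inclusions, is fully faithful and restricts, for
each object `c`, to an isomorphism of `⟨c⟩` onto `⟨F c⟩` (as `F` is fully faithful, bijectivity on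
the morphisms of `⟨c⟩` is the last clause). -/
structure IsLocalIso (F : A ⥤ B) : Prop where
  map_incl : ∀ {a b : A} (j : a ⟶ b), IsIncl j → IsIncl (F.map j)
  full : F.Full
  faithful : F.Faithful
  bijOn : ∀ c : A, Set.BijOn F.obj {a | Sub a c} {b | Sub b (F.obj c)}
  core : ∀ (c : A) {a b : A} (f : a ⟶ b), Sub a c → Sub b c →
    (Core c f ↔ Core (F.obj c) (F.map f))

end LocalIso

section CrossConnections

variable {C D : Type u} [SmallCategory C] [SmallCategory D]
  [CategoryWithSubobjects C] [CategoryWithSubobjects D]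
  [ConsistentCategory C] [ConsistentCategory D]

theorem Cone.component_vertex {ε : Cone C} (h : IsIdempotentElem ε) :
    ε.component ε.vertex = 𝟙 ε.vertex := by
  obtain ⟨a, hm, he⟩ := ε.exists_bimorphism
  have key : ∀ (γ : Cone C) (e : γ.vertex = ε.vertex)
      (_ : ∀ b, γ.component b ≫ eqToHom e = ε.component b) (p : ε.vertex ⟶ γ.vertex),
      γ.component a = ε.component a ≫ p → p ≫ eqToHom e = 𝟙 _ := by
    intro γ e hγ p hp
    rw [← cancel_epi (ε.component a), ← Category.assoc, ← hp, hγ, Category.comp_id]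
  have hv : (ε * ε).vertex = ε.vertex := congrArg Cone.vertex h
  have h1 := key (ε * ε) hv (fun b => by
    have : ∀ (γ δ : Cone C) (e : γ = δ),
        γ.component b ≫ eqToHom (congrArg Cone.vertex e) = δ.component b := by
      rintro γ _ rfl
      simp
    exact this _ _ h) (epiPart (ε.component ε.vertex)) rfl
  have h2 : imIncl (ε.component ε.vertex) = eqToHom hv :=
    CategoryWithSubobjects.incl_thin _ _ (imIncl_isIncl _) (by
      have : ∀ {x y : C} (e : x = y), IsIncl (eqToHom e) := by
        rintro x _ rfl
        exact CategoryWithSubobjects.incl_id x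
      exact this hv)
  rw [← epiPart_comp (ε.component ε.vertex), h2]
  exact h1

theorem Cone.isIdempotentElem_of {ε : Cone C} (h : ε.component ε.vertex = 𝟙 ε.vertex) :
    IsIdempotentElem ε := by
  change ε.act (ε.component ε.vertex) = ε
  rw [h, ε.act_eq_star (𝟙 _) (𝟙 _) (CategoryWithSubobjects.incl_id _) (Category.comp_id _)]
  exact Cone.ext rfl (heq_of_eq (funext fun a => Category.comp_id _))

/-- Each object `c` of the M-set of an H-functor is the vertex of a unique idempotent cone that
defines the same H-functor. -/
theorem Dual.existsUnique_coneAt (A : Dual C) {c : C} (hc : c ∈ A.mSet) :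
    ∃! ξ : Cone C, IsIdempotentElem ξ ∧ ξ.vertex = c ∧ A.functor = H ξ := by
  obtain ⟨ε, hε, hA, hi⟩ := hc
  have hH : ∀ {x : C} (f : ε.vertex ⟶ x), (ε.star (inv (ε.component c))).act
      (ε.component c ≫ f) = ε.act f := by
    intro x f
    exact (Cone.star_act _ _ _).trans
      (congrArg (fun t => ε.act t) (IsIso.inv_hom_id_assoc (ε.component c) f))
  refine ⟨ε.star (inv (ε.component c)), ⟨Cone.isIdempotentElem_of ?_, rfl, ?_⟩, ?_⟩
  · exact IsIso.hom_inv_id (ε.component c)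
  · rw [hA]
    ext x γ
    constructor
    · rintro ⟨f, hf⟩
      exact ⟨ε.component c ≫ f, hf.trans (hH f).symm⟩
    · rintro ⟨f, hf⟩
      exact ⟨inv (ε.component c) ≫ f, hf.trans (Cone.star_act _ _ _)⟩
  · rintro ξ ⟨hξ, rfl, hA'⟩
    have hmem : (⟨ξ, Sub.refl _⟩ : (coneFunctor C).obj ξ.vertex) ∈ (H ε).obj ξ.vertex := by
      rw [← hA, hA']
      refine ⟨𝟙 _, ?_⟩
      change ξ = _
      rw [ξ.act_eq_star (𝟙 _) (𝟙 _) (CategoryWithSubobjects.incl_id _) (Category.comp_id _)]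
      exact Cone.ext rfl (heq_of_eq (funext fun a => (Category.comp_id _).symm))
    obtain ⟨f, hf : ξ = ε.act f⟩ := hmem
    have hv : ξ.vertex = im f := congrArg Cone.vertex hf
    have hcomp : ∀ b : C, ξ.component b ≫ eqToHom hv = ε.component b ≫ epiPart f := by
      have : ∀ (γ δ : Cone C) (e : γ = δ) (b : C),
          γ.component b ≫ eqToHom (congrArg Cone.vertex e) = δ.component b := by
        rintro γ _ rfl b
        simp
      exact this _ _ hf
    have h1 := hcomp ξ.vertex
    rw [Cone.component_vertex hξ, Category.id_comp] at h1
    refine hf.trans (ε.star_congr _ _ hv.symm ?_)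
    rw [← cancel_epi (ε.component ξ.vertex), ← Category.assoc, ← h1]
    simp

/-- The idempotent cone with vertex `c` that defines the H-functor `A`, for `c` in the M-set of
`A`. -/
noncomputable def Dual.coneAt (A : Dual C) {c : C} (hc : c ∈ A.mSet) : Cone C :=
  (A.existsUnique_coneAt hc).choose

theorem Dual.coneAt_spec (A : Dual C) {c : C} (hc : c ∈ A.mSet) :
    IsIdempotentElem (A.coneAt hc) ∧ (A.coneAt hc).vertex = c ∧ A.functor = H (A.coneAt hc) :=
  (A.existsUnique_coneAt hc).choose_spec.1

theorem Dual.coneAt_vertex (A : Dual C) {c : C} (hc : c ∈ A.mSet) : (A.coneAt hc).vertex = c :=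
  (A.coneAt_spec hc).2.1

/-- The component at `b` of the cone `A.coneAt hc`, as a morphism to `c`. -/
noncomputable def Dual.coneAtComponent (A : Dual C) {c : C} (hc : c ∈ A.mSet) (b : C) : b ⟶ c :=
  (A.coneAt hc).component b ≫ eqToHom (A.coneAt_vertex hc)

/-- `g : d' ⟶ d` is the transpose, through `Φ : C ⥤ D*`, of `f : c' ⟶ c`, where `d ∈ MΦ(c')` and
`d' ∈ MΦ(c)`. With `δ = (Φ c').coneAt h'` and `δ' = (Φ c).coneAt h`, and with the natural
isomorphisms `D(d,-) ≅ Φ(c')`, `k ↦ δ ∗ k°` and `D(d',-) ≅ Φ(c)`, `k ↦ δ' ∗ k°`, this says that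
`Φ(f)` corresponds to `D(g,-)`. -/
def IsTranspose (Φ : C ⥤ Dual D) {c' c : C} {d d' : D} (h' : d ∈ (Φ.obj c').mSet)
    (h : d' ∈ (Φ.obj c).mSet) (f : c' ⟶ c) (g : d' ⟶ d) : Prop :=
  ∀ (x : D) (k : d ⟶ x) (y : (Φ.obj c').functor.toFunctor.obj x),
    y.1.1 = ((Φ.obj c').coneAt h').push ((Φ.obj c').coneAt_vertex h') k →
    (Dual.apply (Φ.map f) y).1.1 =
      ((Φ.obj c).coneAt h).push ((Φ.obj c).coneAt_vertex h) (g ≫ k)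

variable (C D) in
/-- A cross-connection between `C` and `D`: local isomorphisms `Γ : D ⥤ C*` and `Δ : C ⥤ D*` with
`c ∈ MΓ(d)` if and only if `d ∈ MΔ(c)`, where `Δ` is dual to `Γ`. Duality means that transposition
through `Γ` inverts transposition through `Δ`, and that the transpose of the component at `c` of
the cone `γ(a,b)` is the component at `b` of the cone `δ(c,d)`. -/
@[ext]
structure CrossConnection where
  Γ : D ⥤ Dual C
  Δ : C ⥤ Dual D
  localIso_Γ : IsLocalIso Γ
  localIso_Δ : IsLocalIso Δ
  mem_iff : ∀ (c : C) (d : D), c ∈ (Γ.obj d).mSet ↔ d ∈ (Δ.obj c).mSet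
  transpose_iff : ∀ {c' c : C} {d d' : D} (h' : c' ∈ (Γ.obj d).mSet) (h : c ∈ (Γ.obj d').mSet)
    (f : c' ⟶ c) (g : d' ⟶ d),
    IsTranspose Δ ((mem_iff c' d).1 h') ((mem_iff c d').1 h) f g ↔ IsTranspose Γ h h' g f
  transpose_component : ∀ {c a : C} {d b : D} (h : c ∈ (Γ.obj d).mSet) (h' : a ∈ (Γ.obj b).mSet),
    IsTranspose Δ ((mem_iff c d).1 h) ((mem_iff a b).1 h')
      ((Γ.obj b).coneAtComponent h' c) ((Δ.obj c).coneAtComponent ((mem_iff c d).1 h) b)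

namespace CrossConnection

variable (Ω : CrossConnection C D)

/-- `(c, d) ∈ E_Ω`. -/
def E (c : C) (d : D) : Prop := c ∈ (Ω.Γ.obj d).mSet

variable {Ω}

theorem E.mem {c : C} {d : D} (h : Ω.E c d) : d ∈ (Ω.Δ.obj c).mSet := (Ω.mem_iff c d).1 h

/-- The idempotent cone `γ(c,d)` of `C`: its vertex is `c` and `H(γ(c,d);-) = Γ(d)`. -/
noncomputable def E.γ {c : C} {d : D} (h : Ω.E c d) : Cone C := (Ω.Γ.obj d).coneAt h

/-- The idempotent cone `δ(c,d)` of `D`: its vertex is `d` and `H(δ(c,d);-) = Δ(c)`. -/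
noncomputable def E.δ {c : C} {d : D} (h : Ω.E c d) : Cone D := (Ω.Δ.obj c).coneAt h.mem

/-- `γ(c,d) ∗ f°` -/
noncomputable def E.pushγ {c : C} {d : D} (h : Ω.E c d) {x : C} (f : c ⟶ x) : Cone C :=
  h.γ.push ((Ω.Γ.obj d).coneAt_vertex h) f

/-- `δ(c,d) ∗ g°` -/
noncomputable def E.pushδ {c : C} {d : D} (h : Ω.E c d) {y : D} (g : d ⟶ y) : Cone D :=
  h.δ.push ((Ω.Δ.obj c).coneAt_vertex h.mem) g

/-- `g : d' ⟶ d` is the transpose of `f : c' ⟶ c`, where `(c',d), (c,d') ∈ E_Ω`. -/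
def Transpose {c' c : C} {d d' : D} (h' : Ω.E c' d) (h : Ω.E c d') (f : c' ⟶ c) (g : d' ⟶ d) :
    Prop :=
  IsTranspose Ω.Δ h'.mem h.mem f g

variable (Ω)

/-- The cone `γ` is linked to the cone `δ`: `γ = γ(c',d) ∗ f° ∈ Γ(c,d)` and
`δ = δ(c,d') ∗ g° ∈ Δ(c,d)` where `g` is the transpose of `f`. -/
def Linked (γ : Cone C) (δ : Cone D) : Prop :=
  ∃ (c' c : C) (d d' : D) (h' : Ω.E c' d) (h : Ω.E c d') (f : c' ⟶ c) (g : d' ⟶ d),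
    Transpose h' h f g ∧ γ = h'.pushγ f ∧ δ = h.pushδ g

/-- The set of linked pairs, in the semigroup of all pairs of consistent cones with the operation
`(γ,δ)(γ',δ') = (γ·γ', δ'·δ)`. -/
def linkedPairs : Set (Cone C × (Cone D)ᵐᵒᵖ) := {p | Ω.Linked p.1 p.2.unop}

end CrossConnection

end CrossConnections

/-! ## The categories of principal left and right ideals of a semigroup -/

section Ideals

variable {S : Type u} [Semigroup S]

variable (S) in
/-- The objects of `𝕃(S)`: the sets `Se`, for idempotents `e`. -/
structure LCat where
  carrier : Set S
  exists_idem : ∃ e : S, IsIdempotentElem e ∧ carrier = {x | ∃ s : S, x = s * e}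

/-- The map `φ : A → B` is the right translation `ρ(e,u,f)`: `e` and `f` are idempotents,
`A = Se`, `B = Sf`, `u ∈ eSf` and `φ x = xu`. -/
def IsRho {A B : LCat S} (φ : A.carrier → B.carrier) (e u f : S) : Prop :=
  IsIdempotentElem e ∧ IsIdempotentElem f ∧ A.carrier = {x | ∃ s : S, x = s * e} ∧
    B.carrier = {x | ∃ s : S, x = s * f} ∧ (∃ s : S, u = e * s * f) ∧
    ∀ x : A.carrier, (φ x : S) = x * u

theorem IsRho.comp {A B B' : LCat S} {φ : A.carrier → B.carrier} {ψ : B.carrier → B'.carrier}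
    {e u f g v h : S} (h₁ : IsRho φ e u f) (h₂ : IsRho ψ g v h) : IsRho (ψ ∘ φ) e (u * v) h := by
  obtain ⟨he, -, hA, -, ⟨s, rfl⟩, hφ⟩ := h₁
  obtain ⟨-, hh, -, hB', ⟨t, rfl⟩, hψ⟩ := h₂
  refine ⟨he, hh, hA, hB', ⟨s * f * (g * t), by simp only [mul_assoc]⟩, fun x => ?_⟩
  rw [Function.comp_apply, hψ, hφ, mul_assoc]

theorem isRho_id (A : LCat S) : ∃ e u f : S, IsRho (id : A.carrier → A.carrier) e u f := by
  obtain ⟨e, he, hA⟩ := A.exists_idem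
  refine ⟨e, e, e, he, he, hA, hA, ⟨e, by rw [he.eq, he.eq]⟩, fun x => ?_⟩
  obtain ⟨s, hs⟩ : (x : S) ∈ {x | ∃ s : S, x = s * e} := hA ▸ x.2
  rw [id, hs, mul_assoc, he.eq]

/-- The category `𝕃(S)`: its morphisms are the maps `ρ(e,u,f)`, composed as maps. -/
instance : SmallCategory (LCat S) where
  Hom A B := {φ : A.carrier → B.carrier // ∃ e u f : S, IsRho φ e u f}
  id A := ⟨id, isRho_id A⟩
  comp φ ψ := ⟨ψ.1 ∘ φ.1, by
    obtain ⟨e, u, f, h₁⟩ := φ.2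
    obtain ⟨g, v, h, h₂⟩ := ψ.2
    exact ⟨e, u * v, h, h₁.comp h₂⟩⟩

/-- The inclusions of `𝕃(S)` are its morphisms that are inclusions of sets. -/
instance : CategoryWithSubobjects (LCat S) where
  incl A B φ := ∀ x : A.carrier, (φ.1 x : S) = x
  incl_id _ _ := rfl
  incl_comp f g hf hg x := (hg (f.1 x)).trans (hf x)
  incl_thin f g hf hg := Subtype.ext (funext fun x => Subtype.ext ((hf x).trans (hg x).symm))
  incl_strict {A B} f g hf hg := by
    obtain ⟨A, hA⟩ := A
    obtain ⟨B, hB⟩ := B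
    obtain rfl : A = B := Set.Subset.antisymm
      (fun x hx => (Eq.mp (congrArg (· ∈ B) (hf ⟨x, hx⟩)) (f.1 ⟨x, hx⟩).2))
      (fun x hx => (Eq.mp (congrArg (· ∈ A) (hg ⟨x, hx⟩)) (g.1 ⟨x, hx⟩).2))
    rfl
  incl_mono {A B} f hf := ⟨fun {Z} g h e => Subtype.ext (funext fun x => Subtype.ext (by
    have e' : f.1 (g.1 x) = f.1 (h.1 x) := congrFun (congrArg Subtype.val e) x
    rw [← hf (g.1 x), e', hf]))⟩
  incl_of_comp h g hg hhg x := (hg (h.1 x)).symm.trans (hhg x)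

variable (S) in
/-- The objects of `ℝ(S)`: the sets `eS`, for idempotents `e`. -/
structure RCat where
  carrier : Set S
  exists_idem : ∃ e : S, IsIdempotentElem e ∧ carrier = {x | ∃ s : S, x = e * s}

/-- The map `φ : A → B` is the left translation `λ(e,u,f)`: `e` and `f` are idempotents,
`A = eS`, `B = fS`, `u ∈ fSe` and `φ x = ux`. -/
def IsLambda {A B : RCat S} (φ : A.carrier → B.carrier) (e u f : S) : Prop :=
  IsIdempotentElem e ∧ IsIdempotentElem f ∧ A.carrier = {x | ∃ s : S, x = e * s} ∧
    B.carrier = {x | ∃ s : S, x = f * s} ∧ (∃ s : S, u = f * s * e) ∧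
    ∀ x : A.carrier, (φ x : S) = u * x

theorem IsLambda.comp {A B B' : RCat S} {φ : A.carrier → B.carrier} {ψ : B.carrier → B'.carrier}
    {e u f g v h : S} (h₁ : IsLambda φ e u f) (h₂ : IsLambda ψ g v h) :
    IsLambda (ψ ∘ φ) e (v * u) h := by
  obtain ⟨he, -, hA, -, ⟨s, rfl⟩, hφ⟩ := h₁
  obtain ⟨-, hh, -, hB', ⟨t, rfl⟩, hψ⟩ := h₂
  refine ⟨he, hh, hA, hB', ⟨t * g * (f * s), by simp only [mul_assoc]⟩, fun x => ?_⟩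
  rw [Function.comp_apply, hψ, hφ, mul_assoc (h * t * g)]

theorem isLambda_id (A : RCat S) : ∃ e u f : S, IsLambda (id : A.carrier → A.carrier) e u f := by
  obtain ⟨e, he, hA⟩ := A.exists_idem
  refine ⟨e, e, e, he, he, hA, hA, ⟨e, by rw [he.eq, he.eq]⟩, fun x => ?_⟩
  obtain ⟨s, hs⟩ : (x : S) ∈ {x | ∃ s : S, x = e * s} := hA ▸ x.2
  rw [id, hs, ← mul_assoc, he.eq]

/-- The category `ℝ(S)`: its morphisms are the maps `λ(e,u,f)`, composed as maps. -/
instance : SmallCategory (RCat S) where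
  Hom A B := {φ : A.carrier → B.carrier // ∃ e u f : S, IsLambda φ e u f}
  id A := ⟨id, isLambda_id A⟩
  comp φ ψ := ⟨ψ.1 ∘ φ.1, by
    obtain ⟨e, u, f, h₁⟩ := φ.2
    obtain ⟨g, v, h, h₂⟩ := ψ.2
    exact ⟨e, v * u, h, h₁.comp h₂⟩⟩

/-- The inclusions of `ℝ(S)` are its morphisms that are inclusions of sets. -/
instance : CategoryWithSubobjects (RCat S) where
  incl A B φ := ∀ x : A.carrier, (φ.1 x : S) = x
  incl_id _ _ := rfl
  incl_comp f g hf hg x := (hg (f.1 x)).trans (hf x)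
  incl_thin f g hf hg := Subtype.ext (funext fun x => Subtype.ext ((hf x).trans (hg x).symm))
  incl_strict {A B} f g hf hg := by
    obtain ⟨A, hA⟩ := A
    obtain ⟨B, hB⟩ := B
    obtain rfl : A = B := Set.Subset.antisymm
      (fun x hx => (Eq.mp (congrArg (· ∈ B) (hf ⟨x, hx⟩)) (f.1 ⟨x, hx⟩).2))
      (fun x hx => (Eq.mp (congrArg (· ∈ A) (hg ⟨x, hx⟩)) (g.1 ⟨x, hx⟩).2))
    rfl
  incl_mono {A B} f hf := ⟨fun {Z} g h e => Subtype.ext (funext fun x => Subtype.ext (by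
    have e' : f.1 (g.1 x) = f.1 (h.1 x) := congrFun (congrArg Subtype.val e) x
    rw [← hf (g.1 x), e', hf]))⟩
  incl_of_comp h g hg hhg x := (hg (h.1 x)).symm.trans (hhg x)

end Ideals

/-- An isomorphism of consistent categories: both categories are consistent, the functor is
bijective on objects and on morphisms, and it preserves and reflects inclusions. -/
structure IsConsistentIso {A B : Type u} [SmallCategory A] [SmallCategory B]
    [CategoryWithSubobjects A] [CategoryWithSubobjects B] (F : A ⥤ B) : Prop where
  source : ConsistentCategory A
  target : ConsistentCategory B
  isCatIso : IsCatIso F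
  incl_iff : ∀ {a b : A} (f : a ⟶ b), IsIncl (F.map f) ↔ IsIncl f

section Functors

variable {C D : Type u} [SmallCategory C] [SmallCategory D]
  [CategoryWithSubobjects C] [CategoryWithSubobjects D]
  [ConsistentCategory C] [ConsistentCategory D] (Ω : CrossConnection C D)
  (S : Subsemigroup (Cone C × (Cone D)ᵐᵒᵖ))

/-- The functor `F : C ⥤ 𝕃(S)` is given by the formulas defining `F_Ω`. For `(c,d) ∈ E_Ω`,
`F(c) = S(γ(c,d),δ(c,d))`; for `f : c ⟶ c'` and `(c,d), (c',d') ∈ E_Ω`, `F(f) = ρ(e,u,e')` where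
`e = (γ(c,d),δ(c,d))`, `e' = (γ(c',d'),δ(c',d'))` and `u = (γ(c,d)∗f°, δ(c',d')∗g°)` with
`g : d' ⟶ d` the transpose of `f`. -/
def IsFOmega (F : C ⥤ LCat S) : Prop :=
  (∀ (c : C) (d : D) (h : Ω.E c d), ∃ e : S, (e : Cone C × (Cone D)ᵐᵒᵖ) = (h.γ, .op h.δ) ∧
    IsIdempotentElem e ∧ (F.obj c).carrier = {x | ∃ s : S, x = s * e}) ∧
  ∀ (c c' : C) (d d' : D) (h : Ω.E c d) (h' : Ω.E c' d') (f : c ⟶ c'),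
    ∃ (g : d' ⟶ d) (e u e' : S), CrossConnection.Transpose h h' f g ∧
      (e : Cone C × (Cone D)ᵐᵒᵖ) = (h.γ, .op h.δ) ∧
      (u : Cone C × (Cone D)ᵐᵒᵖ) = (h.pushγ f, .op (h'.pushδ g)) ∧
      (e' : Cone C × (Cone D)ᵐᵒᵖ) = (h'.γ, .op h'.δ) ∧
      IsRho (F.map f).1 e u e'

/-- The functor `G : D ⥤ ℝ(S)` is given by the formulas defining `G_Ω`. For `(c,d) ∈ E_Ω`,
`G(d) = (γ(c,d),δ(c,d))S`; for `g : d ⟶ d'` and `(c,d), (c',d') ∈ E_Ω`, `G(g) = λ(e,u,e')` where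
`e = (γ(c,d),δ(c,d))`, `e' = (γ(c',d'),δ(c',d'))` and `u = (γ(c',d')∗f°, δ(c,d)∗g°)` with
`f : c' ⟶ c` the morphism whose transpose is `g`. -/
def IsGOmega (G : D ⥤ RCat S) : Prop :=
  (∀ (c : C) (d : D) (h : Ω.E c d), ∃ e : S, (e : Cone C × (Cone D)ᵐᵒᵖ) = (h.γ, .op h.δ) ∧
    IsIdempotentElem e ∧ (G.obj d).carrier = {x | ∃ s : S, x = e * s}) ∧
  ∀ (c c' : C) (d d' : D) (h : Ω.E c d) (h' : Ω.E c' d') (g : d ⟶ d'),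
    ∃ (f : c' ⟶ c) (e u e' : S), CrossConnection.Transpose h' h f g ∧
      (e : Cone C × (Cone D)ᵐᵒᵖ) = (h.γ, .op h.δ) ∧
      (u : Cone C × (Cone D)ᵐᵒᵖ) = (h'.pushγ f, .op (h.pushδ g)) ∧
      (e' : Cone C × (Cone D)ᵐᵒᵖ) = (h'.γ, .op h'.δ) ∧
      IsLambda (G.map g).1 e u e'

end Functors

end CrossConn

open CrossConn

namespace CrossConn

/-! ### Subobjects, and cones viewed in an object above their vertex -/

section Into

variable {C : Type u} [SmallCategory C] [CategoryWithSubobjects C]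

/-! The H-functor of an idempotent cone ε is the right ideal of ε in the semigroup of cones, its
value at c being the elements of the ideal whose vertex lies in c (`mem_H_iff`). By naturality,
every morphism of the dual is left multiplication by the image of a generator (`Dual.apply_eq_mul`).
A functor Γ from D to the dual of C therefore turns morphisms of D into left multiplications by
cones of C.

The relation that carries the proof is `Represents`: a cone δ of D represents a cone γ of C when Γ
takes every component of δ to left multiplication by γ. It is multiplicative with reversed order
(`Represents.mul`). Faithfulness makes γ determine δ among cones with vertices in a common object,
and the covering hypothesis makes δ determine γ in the same sense (`Represents.right_unique`,
`Represents.left_unique`). Fullness produces representing cones (`exists_represents`,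
`Represents.exists_push`). In a cross-connection δ(c,d) represents γ(c,d), transposes are pairs of
morphisms whose translated cones represent one another, and a pair is linked exactly when it is a
represented pair (`linked_iff`). Closure of the linked pairs under products is then immediate.

For a given Γ this forces Δ, as recorded in `IsDualOf`: Δ(c) is the right ideal of a cone that
represents γ(c,d), and Δ(f) is left multiplication by a cone that represents γ(c',d) ∗ f°.
Independence of the choices and functoriality both come from uniqueness of representing cones.
Conversely, every such Δ is a local isomorphism and satisfies the duality conditions
(`IsDualOf.exists_crossConnection`).

In the semigroup of linked pairs, the left ideal of an idempotent e consists of the pairs whose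
first member has its vertex inside that of the first member of e (`principal_eq`). So principal left
ideals correspond to objects of C. A right translation is determined by its value at an idempotent
over c, and the component at c of that value is the corresponding morphism of C
(`exists_translate_of_isRho`). This makes F_Ω bijective. The axioms of a consistent category pass
along such an isomorphism (`IsCatIso.consistentCategory`). Finally, G_Ω is the functor F of the
cross-connection with C and D exchanged, read through the anti-isomorphism that swaps the members of
a linked pair. -/

theorem Sub.hom_eq {a b : C} (h : Sub a b) {j : a ⟶ b} (hj : IsIncl j) : h.hom = j :=
  CategoryWithSubobjects.incl_thin _ _ h.isIncl hj

theorem Sub.trans {a b c : C} (h : Sub a b) (h' : Sub b c) : Sub a c :=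
  ⟨h.hom ≫ h'.hom, CategoryWithSubobjects.incl_comp _ _ h.isIncl h'.isIncl⟩

theorem Sub.antisymm {a b : C} (h : Sub a b) (h' : Sub b a) : a = b :=
  CategoryWithSubobjects.incl_strict _ _ h.isIncl h'.isIncl

theorem Sub.of_eq {a b : C} (h : a = b) : Sub a b := h ▸ Sub.refl a

theorem isIncl_id (a : C) : IsIncl (𝟙 a) := CategoryWithSubobjects.incl_id a

theorem isIncl_eqToHom {a b : C} (h : a = b) : IsIncl (eqToHom h) := by
  subst h
  exact isIncl_id a

theorem Sub.hom_of_eq {a b : C} (h : a = b) (h' : Sub a b) : h'.hom = eqToHom h :=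
  h'.hom_eq (isIncl_eqToHom h)

theorem Sub.hom_refl {a : C} (h : Sub a a) : h.hom = 𝟙 a := h.hom_eq (isIncl_id a)

instance Sub.mono_hom {a b : C} (h : Sub a b) : Mono h.hom :=
  CategoryWithSubobjects.incl_mono _ h.isIncl

/-- The component of a cone at `a`, extended to an object that contains the vertex. -/
noncomputable def Cone.into (γ : Cone C) {d : C} (h : Sub γ.vertex d) (a : C) : a ⟶ d :=
  γ.component a ≫ h.hom

theorem Cone.into_refl (γ : Cone C) (h : Sub γ.vertex γ.vertex) (a : C) :
    γ.into h a = γ.component a := by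
  rw [Cone.into, Sub.hom_refl, Category.comp_id]

theorem Cone.into_comp (γ : Cone C) {d e : C} (h : Sub γ.vertex d) (h' : Sub γ.vertex e)
    {j : d ⟶ e} (hj : IsIncl j) (a : C) : γ.into h a ≫ j = γ.into h' a := by
  rw [Cone.into, Category.assoc, Cone.into,
    h'.hom_eq (CategoryWithSubobjects.incl_comp _ _ h.isIncl hj)]

theorem Cone.incl_comp_into (γ : Cone C) {d a b : C} (h : Sub γ.vertex d) {j : a ⟶ b}
    (hj : IsIncl j) : j ≫ γ.into h b = γ.into h a := by
  rw [Cone.into, ← Category.assoc, γ.compat j hj, Cone.into]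

end Into

/-! ### Products and translates of cones -/

section Cones

variable {C : Type u} [SmallCategory C] [CategoryWithSubobjects C] [ConsistentCategory C]

/-- Some component of the first cone is an epimorphism. At that object the two extensions factor one
morphism through two inclusions, so the inclusion preceded by the epimorphism passes through the
other one. -/
theorem Cone.sub_of_into_eq {γ γ' : Cone C} {d : C} (h : Sub γ.vertex d) (h' : Sub γ'.vertex d)
    (e : ∀ a, γ.into h a = γ'.into h' a) : Sub γ.vertex γ'.vertex := by
  obtain ⟨a, -, ha⟩ := γ.exists_bimorphism
  obtain ⟨i, hi, -⟩ := incl_factor h.isIncl h'.isIncl (e a)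
  exact ⟨i, hi⟩

/-- A cone is determined by its extension to an object containing its vertex. -/
theorem Cone.ext_into {γ γ' : Cone C} {d : C} (h : Sub γ.vertex d) (h' : Sub γ'.vertex d)
    (e : ∀ a, γ.into h a = γ'.into h' a) : γ = γ' := by
  have hv : γ.vertex = γ'.vertex :=
    (Cone.sub_of_into_eq h h' e).antisymm (Cone.sub_of_into_eq h' h fun a => (e a).symm)
  obtain ⟨v, f, hf, hb⟩ := γ
  obtain ⟨v', f', hf', hb'⟩ := γ'
  obtain rfl : v = v' := hv
  refine Cone.ext rfl (heq_of_eq (funext fun a => ?_))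
  exact (cancel_mono h.hom).1 (e a)

omit [ConsistentCategory C] in
theorem Cone.into_eq_of_eq {γ γ' : Cone C} (e : γ = γ') {d : C} (h : Sub γ.vertex d)
    (h' : Sub γ'.vertex d) (a : C) : γ.into h a = γ'.into h' a := by
  subst e
  rfl

theorem Cone.act_sub (γ : Cone C) {d : C} (f : γ.vertex ⟶ d) : Sub (γ.act f).vertex d :=
  ⟨imIncl f, imIncl_isIncl f⟩

theorem Cone.act_into (γ : Cone C) {d : C} (f : γ.vertex ⟶ d) (h : Sub (γ.act f).vertex d)
    (a : C) : (γ.act f).into h a = γ.component a ≫ f := by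
  have : h.hom = imIncl f := h.hom_eq (imIncl_isIncl f)
  rw [Cone.into, this]
  exact (Category.assoc _ _ _).trans (congrArg (γ.component a ≫ ·) (epiPart_comp f))

theorem Cone.act_sub_into (γ : Cone C) {c d : C} (hc : Sub γ.vertex c) (f : c ⟶ d)
    (h : Sub (γ.act (hc.hom ≫ f)).vertex d) (a : C) :
    (γ.act (hc.hom ≫ f)).into h a = γ.into hc a ≫ f := by
  rw [Cone.act_into, Cone.into, Category.assoc]

theorem Cone.push_sub (γ : Cone C) {c d : C} (h : γ.vertex = c) (f : c ⟶ d) :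
    Sub (γ.push h f).vertex d := γ.act_sub _

theorem Cone.push_into (γ : Cone C) {c d : C} (h : γ.vertex = c) (hc : Sub γ.vertex c) (f : c ⟶ d)
    (h' : Sub (γ.push h f).vertex d) (a : C) : (γ.push h f).into h' a = γ.into hc a ≫ f := by
  refine (γ.act_into _ h' a).trans ?_
  rw [Cone.into, hc.hom_of_eq h, Category.assoc]

theorem Cone.mul_sub (γ γ' : Cone C) : Sub (γ * γ').vertex γ'.vertex := γ.act_sub _

theorem Cone.mul_sub_of (γ : Cone C) {γ' : Cone C} {d : C} (h : Sub γ'.vertex d) :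
    Sub (γ * γ').vertex d := (γ.mul_sub γ').trans h

/-- The second factor may be evaluated at any object above the vertex of the first, by its
compatibility with inclusions. Together with `Cone.ext_into` this reduces identities in the
semigroup of cones to identities between morphisms, without images. -/
theorem Cone.mul_into (γ γ' : Cone C) {c d : C} (h : Sub (γ * γ').vertex d)
    (hc : Sub γ.vertex c) (h' : Sub γ'.vertex d) (a : C) :
    (γ * γ').into h a = γ.into hc a ≫ γ'.into h' c := by
  have e : (γ * γ').into (γ.mul_sub γ') a = γ.component a ≫ γ'.component γ.vertex :=
    γ.act_into _ _ a
  rw [← (γ * γ').into_comp (γ.mul_sub γ') h h'.isIncl, e, Category.assoc, Cone.into,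
    Category.assoc, γ'.incl_comp_into h' hc.isIncl, Cone.into]

theorem Cone.into_vertex {ε : Cone C} (hε : IsIdempotentElem ε) {c : C} (hc : ε.vertex = c)
    (h : Sub ε.vertex c) : ε.into h c = 𝟙 c := by
  subst hc
  rw [Cone.into_refl, Cone.component_vertex hε]

/-- The left ideal of an idempotent cone is governed by vertices alone, because its component at its
own vertex is the identity. -/
theorem Cone.mul_eq_self {ε : Cone C} (hε : IsIdempotentElem ε) {γ : Cone C}
    (h : Sub γ.vertex ε.vertex) : γ * ε = γ :=
  Cone.ext_into (γ.mul_sub ε) h fun a => by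
    rw [γ.mul_into ε _ h (Sub.refl _), Cone.into_vertex hε rfl, Category.comp_id]

theorem Cone.into_eq_of_mul_eq {ε γ : Cone C} (e : ε * γ = γ) {c d : C} (hc : Sub ε.vertex c)
    (h : Sub γ.vertex d) (a : C) : γ.into h a = ε.into hc a ≫ γ.into h c := by
  rw [← ε.mul_into γ (ε.mul_sub_of h) hc h a, Cone.into_eq_of_eq e]

theorem Cone.mul_push {ε : Cone C} (hε : IsIdempotentElem ε) {c d : C} (hc : ε.vertex = c)
    (f : c ⟶ d) : ε * ε.push hc f = ε.push hc f := by
  refine Cone.ext_into (ε.mul_sub_of (ε.push_sub hc f)) (ε.push_sub hc f) fun a => ?_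
  rw [ε.mul_into _ _ (Sub.of_eq hc) (ε.push_sub hc f), ε.push_into hc (Sub.of_eq hc),
    ε.push_into hc (Sub.of_eq hc), Cone.into_vertex hε hc, Category.id_comp]

/-- A cone in the right ideal of `ε` is of the form `ε ∗ f°`. -/
theorem Cone.push_into_eq {ε γ : Cone C} (e : ε * γ = γ) {c d : C} (hc : ε.vertex = c)
    (h : Sub γ.vertex d) : ε.push hc (γ.into h c) = γ :=
  Cone.ext_into (ε.push_sub hc _) h fun a => by
    rw [ε.push_into hc (Sub.of_eq hc), ← Cone.into_eq_of_mul_eq e]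

/-- The morphism is recovered as the component of the translated cone at the vertex of the
idempotent. -/
theorem Cone.push_injective {ε : Cone C} (hε : IsIdempotentElem ε) {c d : C} (hc : ε.vertex = c)
    {f g : c ⟶ d} (e : ε.push hc f = ε.push hc g) : f = g := by
  have h := Cone.into_eq_of_eq e (ε.push_sub hc f) (ε.push_sub hc g) c
  rwa [ε.push_into hc (Sub.of_eq hc), ε.push_into hc (Sub.of_eq hc), Cone.into_vertex hε hc,
    Category.id_comp, Category.id_comp] at h

theorem Cone.push_id (ε : Cone C) {c : C} (hc : ε.vertex = c) : ε.push hc (𝟙 c) = ε :=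
  Cone.ext_into (ε.push_sub hc _) (Sub.of_eq hc) fun a => by
    rw [ε.push_into hc (Sub.of_eq hc), Category.comp_id]

theorem Cone.push_mul {ε γ : Cone C} {c c' : C} (hc : ε.vertex = c) (f : c ⟶ c')
    {d : C} (h : Sub γ.vertex d) : ε.push hc f * γ = ε.push hc (f ≫ γ.into h c') := by
  refine Cone.ext_into (Cone.mul_sub_of _ h) (ε.push_sub hc _) fun a => ?_
  rw [Cone.mul_into _ γ _ (ε.push_sub hc f) h, ε.push_into hc (Sub.of_eq hc),
    ε.push_into hc (Sub.of_eq hc), Category.assoc]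

theorem Cone.mul_eq_push (ε : Cone C) {γ : Cone C} {c : C} (hc : ε.vertex = c)
    {d : C} (h : Sub γ.vertex d) : ε * γ = ε.push hc (γ.into h c) :=
  Cone.ext_into (ε.mul_sub_of h) (ε.push_sub hc _) fun a => by
    rw [ε.mul_into γ _ (Sub.of_eq hc) h, ε.push_into hc (Sub.of_eq hc)]

theorem coneFunctor_map_into {c d : C} (g : c ⟶ d) (x : (coneFunctor C).obj c)
    (h : Sub ((coneFunctor C).map g x).1.vertex d) (a : C) :
    ((coneFunctor C).map g x).1.into h a = x.1.into x.2 a ≫ g :=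
  x.1.act_sub_into x.2 g h a

/-! ## The dual as a category of right ideals of the semigroup of cones -/

/-- The cone `γ` belongs to one of the sets `A(c)`. -/
def Dual.Mem (A : Dual C) (γ : Cone C) : Prop :=
  ∃ (c : C) (h : Sub γ.vertex c), (⟨γ, h⟩ : (coneFunctor C).obj c) ∈ A.functor.obj c

/-- A cone x fixed by left multiplication by ε is ε ∗ f° with f its own component at the vertex of
ε. H-functors thereby become right ideals of the semigroup of cones. -/
theorem mem_H_iff {ε : Cone C} (hε : IsIdempotentElem ε) {c : C} (x : (coneFunctor C).obj c) :
    x ∈ (H ε).obj c ↔ ε * x.1 = x.1 := by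
  constructor
  · rintro ⟨f, hf⟩
    have : x.1 = ε.push rfl f := by
      rw [hf, Cone.push, eqToHom_refl, Category.id_comp]
    rw [this, Cone.mul_push hε]
  · intro h
    refine ⟨x.1.into x.2 ε.vertex, ?_⟩
    conv_lhs => rw [← Cone.push_into_eq h rfl x.2]
    rw [Cone.push, eqToHom_refl, Category.id_comp]

/-- The criterion of `mem_H_iff` does not mention the object, so an H-functor can be treated as a
single set of cones. -/
theorem Dual.mem_obj_iff (A : Dual C) {c : C} (x : (coneFunctor C).obj c) :
    x ∈ A.functor.obj c ↔ A.Mem x.1 := by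
  refine ⟨fun h => ⟨c, x.2, h⟩, ?_⟩
  rintro ⟨d, h, hx⟩
  obtain ⟨ε, hε, hA⟩ := A.exists_cone
  rw [hA] at hx ⊢
  exact (mem_H_iff hε _).2 ((mem_H_iff hε (⟨x.1, h⟩ : (coneFunctor C).obj d)).1 hx)

theorem Dual.mem_iff (A : Dual C) {ε : Cone C} (hε : IsIdempotentElem ε) (hA : A.functor = H ε)
    (γ : Cone C) : A.Mem γ ↔ ε * γ = γ := by
  rw [← A.mem_obj_iff (⟨γ, Sub.refl _⟩ : (coneFunctor C).obj γ.vertex), hA]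
  exact mem_H_iff hε _

theorem Dual.mem_self (A : Dual C) {ε : Cone C} (hε : IsIdempotentElem ε)
    (hA : A.functor = H ε) : A.Mem ε := (A.mem_iff hε hA ε).2 hε

theorem Dual.functor_eq_of_mem (A : Dual C) {ε : Cone C} (hε : IsIdempotentElem ε)
    (h : ∀ γ, A.Mem γ ↔ ε * γ = γ) : A.functor = H ε := by
  ext c x
  rw [A.mem_obj_iff, mem_H_iff hε, h]

theorem Dual.ext_mem {A B : Dual C} (h : ∀ γ, A.Mem γ ↔ B.Mem γ) : A = B := by
  obtain ⟨ε, hε, hB⟩ := B.exists_cone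
  have : A.functor = B.functor := by
    rw [hB]
    exact A.functor_eq_of_mem hε fun γ => (h γ).trans (B.mem_iff hε hB γ)
  obtain ⟨_, _⟩ := A
  obtain ⟨_, _⟩ := B
  obtain rfl := this
  rfl

theorem Dual.Mem.mul {A : Dual C} {γ : Cone C} (h : A.Mem γ) (γ' : Cone C) : A.Mem (γ * γ') := by
  obtain ⟨ε, hε, hA⟩ := A.exists_cone
  rw [A.mem_iff hε hA] at h ⊢
  rw [← mul_assoc, h]

/-- The element of `A(c)` given by a cone. -/
def Dual.elt (A : Dual C) {γ : Cone C} (h : A.Mem γ) {c : C} (hc : Sub γ.vertex c) :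
    A.functor.toFunctor.obj c :=
  ⟨⟨γ, hc⟩, (A.mem_obj_iff (⟨γ, hc⟩ : (coneFunctor C).obj c)).2 h⟩

theorem Dual.elt_mem (A : Dual C) {c : C} (x : A.functor.toFunctor.obj c) : A.Mem x.1.1 :=
  (A.mem_obj_iff x.1).1 x.2

theorem Dual.apply_map {A B : Dual C} (τ : A ⟶ B) {c d : C} (g : c ⟶ d)
    (x : A.functor.toFunctor.obj c) :
    Dual.apply τ (A.functor.toFunctor.map g x) = B.functor.toFunctor.map g (Dual.apply τ x) :=
  NatTrans.naturality_apply (show A.functor.toFunctor ⟶ B.functor.toFunctor from τ) g x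

theorem Dual.map_into (A : Dual C) {c d : C} (g : c ⟶ d)
    (x : A.functor.toFunctor.obj c) (h : Sub (A.functor.toFunctor.map g x).1.1.vertex d) (a : C) :
    (A.functor.toFunctor.map g x).1.1.into h a = x.1.1.into x.1.2 a ≫ g :=
  coneFunctor_map_into g x.1 h a

/-- Every morphism of the dual is a left multiplication, by the image of any idempotent generator
of its domain. -/
theorem Dual.apply_eq_mul {A B : Dual C} (τ : A ⟶ B) {ε : Cone C} (hε : IsIdempotentElem ε)
    (hA : A.functor = H ε) {e : C} (he : Sub ε.vertex e) {c : C}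
    (x : A.functor.toFunctor.obj c) :
    (Dual.apply τ x).1.1 =
      (Dual.apply τ (A.elt (A.mem_self hε hA) he)).1.1 * x.1.1 := by
  have hx : ε * x.1.1 = x.1.1 := (A.mem_iff hε hA _).1 (A.elt_mem x)
  set y := A.elt (A.mem_self hε hA) he with hy
  -- As in the Yoneda lemma: x is the image of the generator under the component of x at e, so
  -- naturality determines the value of τ at x.
  have hxy : x = A.functor.toFunctor.map (x.1.1.into x.1.2 e) y := by
    refine Subtype.ext (Subtype.ext (Cone.ext_into x.1.2 (A.functor.toFunctor.map _ y).1.2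
      fun a => ?_))
    rw [A.map_into]
    exact Cone.into_eq_of_mul_eq hx he x.1.2 a
  refine Cone.ext_into (Dual.apply τ x).1.2 (Cone.mul_sub_of _ x.1.2) fun a => ?_
  rw [Cone.mul_into _ _ _ (Dual.apply τ y).1.2 x.1.2,
    ← B.map_into _ _ (B.functor.toFunctor.map _ _).1.2 a,
    ← Dual.apply_map, ← hxy]

/-- Left multiplication by `u`, as a morphism of the dual. -/
noncomputable def Dual.mulLeft (A B : Dual C) (u : Cone C) (h : ∀ γ, A.Mem γ → B.Mem (u * γ)) :
    A ⟶ B :=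
  show A.functor.toFunctor ⟶ B.functor.toFunctor from
  { app := fun c => TypeCat.ofHom fun x =>
      B.elt (h x.1.1 (A.elt_mem x)) (u.mul_sub_of x.1.2)
    naturality := fun c d g => by
      refine ConcreteCategory.hom_ext _ _ fun x => Subtype.ext (Subtype.ext ?_)
      change u * (A.functor.toFunctor.map g x).1.1 =
        (B.functor.toFunctor.map g (B.elt (h x.1.1 (A.elt_mem x)) (u.mul_sub_of x.1.2))).1.1
      refine Cone.ext_into (u.mul_sub_of (A.functor.toFunctor.map g x).1.2)
        (B.functor.toFunctor.map g _).1.2 fun a => ?_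
      rw [B.map_into, Cone.mul_into _ _ _ (Sub.refl _) (A.functor.toFunctor.map g x).1.2,
        A.map_into]
      change _ = (u * x.1.1).into (u.mul_sub_of x.1.2) a ≫ g
      rw [Cone.mul_into _ _ _ (Sub.refl _) x.1.2, Category.assoc] }

theorem Dual.mulLeft_apply {A B : Dual C} (u : Cone C) (h : ∀ γ, A.Mem γ → B.Mem (u * γ))
    {c : C} (x : A.functor.toFunctor.obj c) :
    (Dual.apply (Dual.mulLeft A B u h) x).1.1 = u * x.1.1 := rfl

theorem Dual.comp_apply {A B B' : Dual C} (σ : A ⟶ B) (τ : B ⟶ B') {c : C}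
    (x : A.functor.toFunctor.obj c) : Dual.apply (σ ≫ τ) x = Dual.apply τ (Dual.apply σ x) := rfl

theorem Dual.id_apply (A : Dual C) {c : C} (x : A.functor.toFunctor.obj c) :
    Dual.apply (𝟙 A) x = x := rfl

theorem Dual.sub_iff {A B : Dual C} : Sub A B ↔ ∀ γ, A.Mem γ → B.Mem γ := by
  constructor
  · rintro ⟨j, hj⟩ γ hγ
    have h := B.elt_mem (Dual.apply j (A.elt hγ (Sub.refl _)))
    rwa [hj] at h
  · intro h
    obtain ⟨ε, hε, hA⟩ := A.exists_cone
    have key : ∀ γ, A.Mem γ → ε * γ = γ := fun γ => (A.mem_iff hε hA γ).1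
    exact ⟨Dual.mulLeft A B ε fun γ hγ => by rw [key γ hγ]; exact h γ hγ,
      fun c x => key _ (A.elt_mem x)⟩

theorem Dual.exists_mSet (A : Dual C) : ∃ c, c ∈ A.mSet := by
  obtain ⟨ε, hε, hA⟩ := A.exists_cone
  refine ⟨ε.vertex, ε, hε, hA, ?_⟩
  rw [Cone.component_vertex hε]
  infer_instance

theorem Dual.coneAt_idem (A : Dual C) {c : C} (hc : c ∈ A.mSet) :
    IsIdempotentElem (A.coneAt hc) := (A.coneAt_spec hc).1

theorem Dual.coneAt_functor (A : Dual C) {c : C} (hc : c ∈ A.mSet) :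
    A.functor = H (A.coneAt hc) := (A.coneAt_spec hc).2.2

theorem Dual.coneAt_sub (A : Dual C) {c : C} (hc : c ∈ A.mSet) : Sub (A.coneAt hc).vertex c :=
  Sub.of_eq (A.coneAt_vertex hc)

theorem Dual.coneAt_mem (A : Dual C) {c : C} (hc : c ∈ A.mSet) : A.Mem (A.coneAt hc) :=
  A.mem_self (A.coneAt_idem hc) (A.coneAt_functor hc)

theorem Dual.mem_iff_coneAt (A : Dual C) {c : C} (hc : c ∈ A.mSet) (γ : Cone C) :
    A.Mem γ ↔ A.coneAt hc * γ = γ := A.mem_iff (A.coneAt_idem hc) (A.coneAt_functor hc) γ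

theorem Dual.coneAtComponent_eq (A : Dual C) {c : C} (hc : c ∈ A.mSet) (b : C) :
    A.coneAtComponent hc b = (A.coneAt hc).into (A.coneAt_sub hc) b := by
  rw [Cone.into, (A.coneAt_sub hc).hom_of_eq (A.coneAt_vertex hc), Dual.coneAtComponent]

theorem Dual.eq_coneAt (A : Dual C) {c : C} (hc : c ∈ A.mSet) {ε : Cone C}
    (hε : IsIdempotentElem ε) (hv : ε.vertex = c) (hA : A.functor = H ε) : ε = A.coneAt hc :=
  (A.existsUnique_coneAt hc).unique ⟨hε, hv, hA⟩ (A.coneAt_spec hc)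

theorem Dual.mem_mSet_of_vertex (A : Dual C) {ε : Cone C} {c : C} (hε : IsIdempotentElem ε)
    (hv : ε.vertex = c) (hA : A.functor = H ε) : c ∈ A.mSet := by
  subst hv
  refine ⟨ε, hε, hA, ?_⟩
  rw [Cone.component_vertex hε]
  infer_instance

/-- The transpose of a morphism through a functor to the dual, in terms of left multiplication. -/
theorem isTranspose_iff {B : Type u} [SmallCategory B] (Φ : B ⥤ Dual C) {c' c : B} {d d' : C}
    (h' : d ∈ (Φ.obj c').mSet) (h : d' ∈ (Φ.obj c).mSet) (f : c' ⟶ c) (g : d' ⟶ d) :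
    IsTranspose Φ h' h f g ↔ ∀ (x : C) (y : (Φ.obj c').functor.toFunctor.obj x),
      (Dual.apply (Φ.map f) y).1.1 =
        ((Φ.obj c).coneAt h).push ((Φ.obj c).coneAt_vertex h) g * y.1.1 := by
  constructor
  · intro H x y
    -- Every y in the right ideal has the form ε ∗ k°, with k its component at the vertex d of the
    -- generator ε, so the test elements in the definition exhaust the domain.
    have e := (Dual.mem_iff_coneAt _ h' _).1 (Dual.elt_mem _ y)
    rw [H x (y.1.1.into y.1.2 d) y (Cone.push_into_eq e _ y.1.2).symm, Cone.push_mul]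
  · intro H x k y hy
    rw [H x y, Cone.push_mul _ _ y.1.2]
    congr 2
    rw [Cone.into_eq_of_eq hy _ (Cone.push_sub _ _ _), Cone.push_into _ _ (Dual.coneAt_sub _ h'),
      Cone.into_vertex (Dual.coneAt_idem _ h') (Dual.coneAt_vertex _ h'), Category.id_comp]

end Cones
end CrossConn

namespace CrossConn

/-! ### Cones of D representing cones of C -/

section Represents

variable {C D : Type u} [SmallCategory C] [SmallCategory D]
  [CategoryWithSubobjects C] [CategoryWithSubobjects D]
  [ConsistentCategory C] [ConsistentCategory D]

/-- The functor `Γ` takes the components of the cone `δ` to left multiplication by `γ`. -/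
def Represents (Γ : D ⥤ Dual C) (γ : Cone C) (δ : Cone D) : Prop :=
  ∀ (b : D) (z : C) (x : (Γ.obj b).functor.toFunctor.obj z),
    (Dual.apply (Γ.map (δ.component b)) x).1.1 = γ * x.1.1

variable {Γ : D ⥤ Dual C}

omit [ConsistentCategory D] in
theorem apply_map_comp_incl (hΓ : IsLocalIso Γ) {a b c : D} (f : a ⟶ b) {j : b ⟶ c}
    (hj : IsIncl j) {z : C} (x : (Γ.obj a).functor.toFunctor.obj z) :
    (Dual.apply (Γ.map (f ≫ j)) x).1.1 = (Dual.apply (Γ.map f) x).1.1 := by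
  rw [Γ.map_comp, Dual.comp_apply]
  exact hΓ.map_incl j hj _ _

omit [ConsistentCategory D] in
theorem Represents.apply_into (hΓ : IsLocalIso Γ) {γ : Cone C} {δ : Cone D}
    (H : Represents Γ γ δ) {d : D} (h : Sub δ.vertex d) (b : D) {z : C}
    (x : (Γ.obj b).functor.toFunctor.obj z) :
    (Dual.apply (Γ.map (δ.into h b)) x).1.1 = γ * x.1.1 :=
  (apply_map_comp_incl hΓ _ h.isIncl x).trans (H b z x)

omit [ConsistentCategory D] in
theorem Represents.of_into (hΓ : IsLocalIso Γ) {γ : Cone C} {δ : Cone D} {d : D}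
    (h : Sub δ.vertex d) (H : ∀ (b : D) (z : C) (x : (Γ.obj b).functor.toFunctor.obj z),
      (Dual.apply (Γ.map (δ.into h b)) x).1.1 = γ * x.1.1) : Represents Γ γ δ :=
  fun b z x => (apply_map_comp_incl hΓ _ h.isIncl x).symm.trans (H b z x)

/-- A component of a product of cones is a composite of components, and Γ sends it to a composite of
left multiplications. The order reverses because the multiplication applied first stands on the
right. -/
theorem Represents.mul (hΓ : IsLocalIso Γ) {γ γ' : Cone C} {δ δ' : Cone D}
    (H : Represents Γ γ δ) (H' : Represents Γ γ' δ') : Represents Γ (γ * γ') (δ' * δ) := by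
  refine Represents.of_into hΓ (δ'.mul_sub δ) fun b z x => ?_
  rw [δ'.mul_into δ _ (Sub.refl _) (Sub.refl _), Cone.into_refl, Cone.into_refl, Γ.map_comp,
    Dual.comp_apply, H, H', mul_assoc]

omit [ConsistentCategory D] in
-- The covering hypothesis supplies an idempotent cone with the same vertex as γ. It is a right
-- identity for γ, so γ is itself a value of a map with codomain Γ of the vertex of δ.
theorem Represents.mem (hcov : ∀ c : C, ∃ d : D, c ∈ (Γ.obj d).mSet) {γ : Cone C} {δ : Cone D}
    (H : Represents Γ γ δ) : (Γ.obj δ.vertex).Mem γ := by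
  obtain ⟨d, hd⟩ := hcov γ.vertex
  have h := H d _ ((Γ.obj d).elt ((Γ.obj d).coneAt_mem hd) (Sub.refl _))
  have e : γ * (Γ.obj d).coneAt hd = γ :=
    Cone.mul_eq_self ((Γ.obj d).coneAt_idem hd) (Sub.of_eq ((Γ.obj d).coneAt_vertex hd).symm)
  rw [← e]
  exact h ▸ Dual.elt_mem _ _

/-- This is faithfulness of Γ. The common object d makes the components of the two cones parallel
morphisms. -/
theorem Represents.right_unique (hΓ : IsLocalIso Γ) {γ : Cone C} {δ δ' : Cone D}
    (H : Represents Γ γ δ) (H' : Represents Γ γ δ') {d : D} (h : Sub δ.vertex d)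
    (h' : Sub δ'.vertex d) : δ = δ' := by
  refine Cone.ext_into h h' fun b => hΓ.faithful.map_injective (Dual.hom_ext _ _ fun z x => ?_)
  rw [H.apply_into hΓ, H'.apply_into hΓ]

omit [ConsistentCategory D] in
-- Both multiplications are evaluated at an idempotent cone with vertex c, which is a right identity
-- for each of the two cones.
theorem Represents.left_unique (hcov : ∀ c : C, ∃ d : D, c ∈ (Γ.obj d).mSet)
    {γ γ' : Cone C} {δ : Cone D} (H : Represents Γ γ δ) (H' : Represents Γ γ' δ) {c : C}
    (h : Sub γ.vertex c) (h' : Sub γ'.vertex c) : γ = γ' := by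
  obtain ⟨d, hd⟩ := hcov c
  have e : ∀ {γ : Cone C}, Sub γ.vertex c → γ * (Γ.obj d).coneAt hd = γ := fun h =>
    Cone.mul_eq_self ((Γ.obj d).coneAt_idem hd)
      (h.trans (Sub.of_eq ((Γ.obj d).coneAt_vertex hd).symm))
  have h₁ := H d _ ((Γ.obj d).elt ((Γ.obj d).coneAt_mem hd) (Sub.refl _))
  have h₂ := H' d _ ((Γ.obj d).elt ((Γ.obj d).coneAt_mem hd) (Sub.refl _))
  rw [← e h, ← e h']
  exact h₁.symm.trans h₂

/-- If `γ` is in the left ideal of an idempotent represented by a cone with vertex `d'`, and in the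
right ideal `Γ(d)`, then `γ` is represented by a translate of that cone. -/
theorem Represents.exists_push (hΓ : IsLocalIso Γ) {ε : Cone C} (hε : IsIdempotentElem ε)
    {δ : Cone D} {d' d : D} (hv : δ.vertex = d')
    (R : Represents Γ ε δ) {γ : Cone C} (hs : Sub γ.vertex ε.vertex) (hm : (Γ.obj d).Mem γ) :
    ∃ g : d' ⟶ d, Represents Γ γ (δ.push hv g) := by
  have := hΓ.full
  obtain ⟨g, hg⟩ := Γ.map_surjective
    (Dual.mulLeft (Γ.obj d') (Γ.obj d) γ fun γ' _ => hm.mul γ')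
  refine ⟨g, Represents.of_into hΓ (δ.push_sub hv g) fun b z x => ?_⟩
  rw [δ.push_into hv (Sub.of_eq hv), Γ.map_comp, Dual.comp_apply, hg, Dual.mulLeft_apply,
    R.apply_into hΓ, ← mul_assoc, Cone.mul_eq_self hε hs]

/-- The component of δ at d' is the identity, so representation at d' already says that Γ(g) is the
required left multiplication. At the other objects it follows because the translated cone has its
vertex in c and absorbs γ(c,d') on the right. -/
theorem isTranspose_iff_represents (hΓ : IsLocalIso Γ) {c' c : C} {d d' : D}
    (h' : c' ∈ (Γ.obj d).mSet) (h : c ∈ (Γ.obj d').mSet) {δ : Cone D} (hδ : IsIdempotentElem δ)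
    (hv : δ.vertex = d') (R : Represents Γ ((Γ.obj d').coneAt h) δ) (f : c' ⟶ c) (g : d' ⟶ d) :
    IsTranspose Γ h h' g f ↔
      Represents Γ (((Γ.obj d).coneAt h').push ((Γ.obj d).coneAt_vertex h') f)
        (δ.push hv g) := by
  rw [isTranspose_iff]
  constructor
  · intro H
    refine Represents.of_into hΓ (δ.push_sub hv g) fun b z x => ?_
    rw [δ.push_into hv (Sub.of_eq hv), Γ.map_comp, Dual.comp_apply, H, R.apply_into hΓ, ← mul_assoc,
      Cone.mul_eq_self (Dual.coneAt_idem _ h)]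
    exact (Cone.push_sub _ _ _).trans (Sub.of_eq (Dual.coneAt_vertex _ h).symm)
  · intro H z y
    rw [← H.apply_into hΓ (δ.push_sub hv g) d' y, δ.push_into hv (Sub.of_eq hv),
      Cone.into_vertex hδ hv, Category.id_comp]

end Represents

/-! ### Linked pairs of a cross-connection are the represented pairs -/

namespace CrossConnection

variable {C D : Type u} [SmallCategory C] [SmallCategory D]
  [CategoryWithSubobjects C] [CategoryWithSubobjects D]
  [ConsistentCategory C] [ConsistentCategory D] {Ω : CrossConnection C D}

theorem exists_right (Ω : CrossConnection C D) (c : C) : ∃ d : D, Ω.E c d := by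
  obtain ⟨d, hd⟩ := (Ω.Δ.obj c).exists_mSet
  exact ⟨d, (Ω.mem_iff c d).2 hd⟩

theorem exists_left (Ω : CrossConnection C D) (d : D) : ∃ c : C, Ω.E c d :=
  (Ω.Γ.obj d).exists_mSet

theorem E.γ_idem {c : C} {d : D} (h : Ω.E c d) : IsIdempotentElem h.γ := Dual.coneAt_idem _ h

theorem E.δ_idem {c : C} {d : D} (h : Ω.E c d) : IsIdempotentElem h.δ := Dual.coneAt_idem _ h.mem

theorem E.γ_vertex {c : C} {d : D} (h : Ω.E c d) : h.γ.vertex = c := Dual.coneAt_vertex _ h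

theorem E.δ_vertex {c : C} {d : D} (h : Ω.E c d) : h.δ.vertex = d := Dual.coneAt_vertex _ h.mem

theorem E.γ_sub {c : C} {d : D} (h : Ω.E c d) : Sub h.γ.vertex c := Sub.of_eq h.γ_vertex

theorem represents_coneAt (Ω : CrossConnection C D) {c : C} {d : D}
    (h : c ∈ (Ω.Γ.obj d).mSet) : Represents Ω.Γ ((Ω.Γ.obj d).coneAt h)
      ((Ω.Δ.obj c).coneAt ((Ω.mem_iff c d).1 h)) := by
  refine Represents.of_into Ω.localIso_Γ (Dual.coneAt_sub _ _) fun b z x => ?_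
  -- For any a in MΓ(b), the duality axiom makes Γ of the component at b left multiplication by
  -- γ(c,d) · γ(a,b). The second factor fixes every element of Γ(b) and drops out.
  obtain ⟨a, h'⟩ := (Ω.Γ.obj b).exists_mSet
  have T := Ω.transpose_component h h'
  rw [Ω.transpose_iff h h', isTranspose_iff, Dual.coneAtComponent_eq,
    Dual.coneAtComponent_eq] at T
  rw [T z x, ← Cone.mul_eq_push, mul_assoc,
    (Dual.mem_iff_coneAt _ h' _).1 (Dual.elt_mem _ x)]

/-- `Γ` takes the components of `δ(c,d)` to left multiplication by `γ(c,d)`. -/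
theorem E.represents {c : C} {d : D} (h : Ω.E c d) : Represents Ω.Γ h.γ h.δ :=
  Ω.represents_coneAt h

theorem transpose_iff_represents {c' c : C} {d d' : D} (h' : Ω.E c' d) (h : Ω.E c d')
    (f : c' ⟶ c) (g : d' ⟶ d) :
    Transpose h' h f g ↔ Represents Ω.Γ (h'.pushγ f) (h.pushδ g) :=
  (Ω.transpose_iff h' h f g).trans
    (isTranspose_iff_represents Ω.localIso_Γ h' h h.δ_idem h.δ_vertex h.represents f g)

/-- For a represented pair, the idempotents over the vertices of γ and δ can be used: γ lies in the
right ideal Γ of the vertex of δ, and δ is fixed by δ(c,d') because both cones represent γ = γ ·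
γ(c,d'). The morphisms of the linked pair are the corresponding components. -/
theorem linked_iff (Ω : CrossConnection C D) (γ : Cone C) (δ : Cone D) :
    Ω.Linked γ δ ↔ Represents Ω.Γ γ δ := by
  constructor
  · rintro ⟨c', c, d, d', h', h, f, g, T, rfl, rfl⟩
    exact (transpose_iff_represents h' h f g).1 T
  · intro R
    obtain ⟨d', h⟩ := Ω.exists_right γ.vertex
    obtain ⟨c', h'⟩ := Ω.exists_left δ.vertex
    have hm := R.mem Ω.exists_right
    have hγ : h'.pushγ (γ.into (Sub.refl _) c') = γ :=
      Cone.push_into_eq ((Dual.mem_iff_coneAt _ h' _).1 hm) _ _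
    have hδ' : h.δ * δ = δ := by
      refine Represents.right_unique Ω.localIso_Γ (γ := γ) ?_ R (h.δ.mul_sub δ) (Sub.refl _)
      have := R.mul Ω.localIso_Γ h.represents
      rwa [Cone.mul_eq_self h.γ_idem (Sub.of_eq h.γ_vertex.symm)] at this
    have hδ : h.pushδ (δ.into (Sub.refl _) d') = δ := Cone.push_into_eq hδ' _ _
    refine ⟨c', γ.vertex, δ.vertex, d', h', h, _, _, ?_, hγ.symm, hδ.symm⟩
    rw [transpose_iff_represents, hγ, hδ]
    exact R

/-- Fullness of Γ is what yields g: left multiplication by γ(c',d) ∗ f° maps Γ(d') into the right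
ideal Γ(d). -/
theorem exists_transpose {c' c : C} {d d' : D} (h' : Ω.E c' d) (h : Ω.E c d') (f : c' ⟶ c) :
    ∃ g : d' ⟶ d, Transpose h' h f g := by
  have hm : (Ω.Γ.obj d).Mem (h'.pushγ f) :=
    (Dual.mem_iff_coneAt _ h' _).2 (Cone.mul_push h'.γ_idem h'.γ_vertex f)
  obtain ⟨g, hg⟩ := Represents.exists_push Ω.localIso_Γ h.γ_idem h.δ_vertex h.represents
    (γ := h'.pushγ f) ((Cone.push_sub _ _ _).trans (Sub.of_eq h.γ_vertex.symm)) hm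
  exact ⟨g, (transpose_iff_represents h' h f g).2 hg⟩

end CrossConnection
end CrossConn

namespace CrossConn

/-! ### A criterion for local isomorphisms -/

section LocalIso

variable {A B : Type u} [SmallCategory A] [SmallCategory B]
  [CategoryWithSubobjects A] [CategoryWithSubobjects B]

/-- A fully faithful functor that preserves inclusions and restricts to bijections between sets of
subobjects is a local isomorphism. -/
theorem IsLocalIso.of_bijOn {F : A ⥤ B}
    (map_incl : ∀ {a b : A} (j : a ⟶ b), IsIncl j → IsIncl (F.map j))
    (full : F.Full) (faithful : F.Faithful)
    (bijOn : ∀ c : A, Set.BijOn F.obj {a | Sub a c} {b | Sub b (F.obj c)}) : IsLocalIso F := by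
  -- Reflection of inclusions: surjectivity below b gives some a' ⊆ b with the same image as a,
  -- injectivity below c identifies it with a, and inclusions are unique.
  have refl_incl : ∀ {c a b : A}, Sub a c → Sub b c → ∀ f : a ⟶ b, IsIncl (F.map f) → IsIncl f := by
    intro c a b ha hb f hf
    obtain ⟨a', ha', e⟩ := (bijOn b).surjOn (show F.obj a ∈ {x | Sub x (F.obj b)} from ⟨_, hf⟩)
    obtain rfl : a' = a := (bijOn c).injOn (Sub.trans ha' hb) ha e
    obtain ⟨j, hj⟩ := ha'
    obtain rfl : j = f :=
      F.map_injective (CategoryWithSubobjects.incl_thin _ _ (map_incl j hj) hf)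
    exact hj
  have mapsub : ∀ {a b : A}, Sub a b → Sub (F.obj a) (F.obj b) := fun ⟨j, hj⟩ =>
    ⟨F.map j, map_incl j hj⟩
  refine ⟨map_incl, full, faithful, bijOn, fun c a b f ha hb => ⟨fun h => ?_, fun h => ?_⟩⟩
  · clear ha hb
    induction h with
    | incl f ha hb hf => exact .incl _ (mapsub ha) (mapsub hb) (map_incl f hf)
    | retr f ha hb hf =>
      obtain ⟨j, hj, e⟩ := hf
      exact .retr _ (mapsub ha) (mapsub hb)
        ⟨F.map j, map_incl j hj, by rw [← F.map_comp, e, F.map_id]⟩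
    | comp f g _ _ hf hg =>
      rw [F.map_comp]
      exact .comp _ _ hf hg
  · have sub : ∀ {x y : B} (g : x ⟶ y), Core (F.obj c) g →
        Sub x (F.obj c) ∧ Sub y (F.obj c) := by
      intro x y g hg
      induction hg with
      | incl f ha hb hf => exact ⟨ha, hb⟩
      | retr f ha hb hf => exact ⟨ha, hb⟩
      | comp f g _ _ hf hg => exact ⟨hf.1, hg.2⟩
    -- The endpoints are freed for the induction. Intermediate objects in a composite of generators
    -- lie below F(c), hence come from subobjects of c.
    have key : ∀ {x y : B} (g : x ⟶ y), Core (F.obj c) g → ∀ (a b : A), Sub a c → Sub b c →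
        ∀ (ea : F.obj a = x) (eb : F.obj b = y) (f : a ⟶ b),
        F.map f = eqToHom ea ≫ g ≫ eqToHom eb.symm → Core c f := by
      intro x y g hg
      induction hg with
      | incl g _ _ hg =>
        rintro a b ha hb rfl rfl f hf
        simp only [eqToHom_refl, Category.id_comp, Category.comp_id] at hf
        subst hf
        exact .incl _ ha hb (refl_incl ha hb f hg)
      | retr g _ _ hg =>
        rintro a b ha hb rfl rfl f hf
        simp only [eqToHom_refl, Category.id_comp, Category.comp_id] at hf
        subst hf
        obtain ⟨j, hj, e⟩ := hg
        obtain ⟨j, rfl⟩ := F.map_surjective j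
        exact .retr _ ha hb ⟨j, refl_incl hb ha j hj, F.map_injective (by
          rw [F.map_comp, e, F.map_id])⟩
      | @comp x y z g g' hg hg' ih ih' =>
        rintro a b ha hb rfl rfl f hf
        obtain ⟨a', ha', rfl⟩ := (bijOn c).surjOn (sub g hg).2
        obtain ⟨g, rfl⟩ := F.map_surjective g
        obtain ⟨g', rfl⟩ := F.map_surjective g'
        obtain rfl : f = g ≫ g' := F.map_injective (by simpa using hf)
        exact .comp _ _ (ih a a' ha ha' rfl rfl g (by simp))
          (ih' a' b ha' hb rfl rfl g' (by simp))
    exact key _ h a b ha hb rfl rfl f (by simp)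

end LocalIso

/-! ### Uniqueness of the dual functor -/

section DualFunctor

variable {C D : Type u} [SmallCategory C] [SmallCategory D]
  [CategoryWithSubobjects C] [CategoryWithSubobjects D]
  [ConsistentCategory C] [ConsistentCategory D]

theorem Cone.push_congr {γ γ' : Cone C} (e : γ = γ') {c d : C} (h : γ.vertex = c)
    (h' : γ'.vertex = c) (f : c ⟶ d) : γ.push h f = γ'.push h' f := by
  subst e
  rfl

theorem Cone.mul_push_of_vertex {ε ε' : Cone C} (hε' : IsIdempotentElem ε') {c d : C}
    (h : ε.vertex = c) (h' : ε'.vertex = c) (f : c ⟶ d) : ε * ε'.push h' f = ε.push h f := by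
  rw [ε.mul_eq_push h (ε'.push_sub h' f), ε'.push_into h' (Sub.of_eq h'),
    Cone.into_vertex hε' h', Category.id_comp]

theorem Cone.push_incl (ε : Cone C) {c d : C} (h : ε.vertex = c) {j : c ⟶ d} (hj : IsIncl j) :
    ε.push h j = ε := by
  have h' : Sub ε.vertex d := (Sub.of_eq h).trans ⟨j, hj⟩
  refine Cone.ext_into (ε.push_sub h j) h' fun a => ?_
  rw [ε.push_into h (Sub.of_eq h), ε.into_comp _ h' hj]

theorem Dual.heq_of_apply {A B A' B' : Dual C} (hA : A = A') (hB : B = B') (τ : A ⟶ B)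
    (τ' : A' ⟶ B') (h : ∀ (c : C) (x : A.functor.toFunctor.obj c)
      (x' : A'.functor.toFunctor.obj c), x.1.1 = x'.1.1 →
      (Dual.apply τ x).1.1 = (Dual.apply τ' x').1.1) : HEq τ τ' := by
  subst hA hB
  exact heq_of_eq (Dual.hom_ext _ _ fun c x => h c x x rfl)

/-- An idempotent cone of `D` and a cone of `C` that represents it generate corresponding
objects. -/
theorem Represents.idem {Γ : D ⥤ Dual C} (hcov : ∀ c : C, ∃ d : D, c ∈ (Γ.obj d).mSet)
    {γ : Cone C} {δ : Cone D} (R : Represents Γ γ δ) (hδ : IsIdempotentElem δ) :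
    IsIdempotentElem γ ∧ (Γ.obj δ.vertex).functor = H γ := by
  have hm := R.mem hcov
  have key : ∀ γ', (Γ.obj δ.vertex).Mem γ' → γ * γ' = γ' := by
    intro γ' h
    have h' := R _ _ ((Γ.obj δ.vertex).elt h (Sub.refl _))
    rw [Cone.component_vertex hδ, Γ.map_id, Dual.id_apply] at h'
    exact h'.symm
  exact ⟨key γ hm, Dual.functor_eq_of_mem _ (key γ hm) fun γ' => ⟨key γ', fun h => h ▸ hm.mul γ'⟩⟩

/-- Left multiplication by γ(c,d) maps every Γ(b) into Γ(d), so fullness provides the components.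
Faithfulness gives compatibility with inclusions, and also the identity at d, since γ(c,d) acts
trivially on its own right ideal. That identity supplies the bimorphism and the idempotency. -/
theorem exists_represents {Γ : D ⥤ Dual C} (hΓ : IsLocalIso Γ) {c : C} {d : D}
    (h : c ∈ (Γ.obj d).mSet) : ∃ δ : Cone D, δ.vertex = d ∧ IsIdempotentElem δ ∧
      Represents Γ ((Γ.obj d).coneAt h) δ := by
  have := hΓ.full
  have := hΓ.faithful
  have ex : ∀ b, ∃ g : b ⟶ d, ∀ (z : C) (x : (Γ.obj b).functor.toFunctor.obj z),
      (Dual.apply (Γ.map g) x).1.1 = (Γ.obj d).coneAt h * x.1.1 := by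
    intro b
    obtain ⟨g, hg⟩ := Γ.map_surjective
      (Dual.mulLeft (Γ.obj b) (Γ.obj d) _ fun γ' _ => ((Γ.obj d).coneAt_mem h).mul γ')
    exact ⟨g, fun z x => by rw [hg, Dual.mulLeft_apply]⟩
  choose g hg using ex
  have hid : g d = 𝟙 d := Γ.map_injective (Dual.hom_ext _ _ fun z x => by
    rw [hg, Γ.map_id, Dual.id_apply]
    exact (Dual.mem_iff_coneAt _ h _).1 (Dual.elt_mem _ x))
  let δ : Cone D := ⟨d, g, fun {a b} j hj => Γ.map_injective (Dual.hom_ext _ _ fun z x => by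
      rw [Γ.map_comp, Dual.comp_apply, hg, hg]
      exact congrArg (_ * ·) (hΓ.map_incl j hj z x)), d, by
    rw [hid]
    exact ⟨inferInstance, inferInstance⟩⟩
  exact ⟨δ, rfl, Cone.isIdempotentElem_of hid, hg⟩

/-- `Φ : C ⥤ D*` is dual to `Γ`, in terms of the representation of cones. -/
structure IsDualOf (Γ : D ⥤ Dual C) (Φ : C ⥤ Dual D) : Prop where
  obj : ∀ {c : C} {d : D} (h : c ∈ (Γ.obj d).mSet) {δ : Cone D}, δ.vertex = d →
    Represents Γ ((Γ.obj d).coneAt h) δ → (Φ.obj c).functor = H δ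
  map : ∀ {c' c : C} {d : D} (h' : c' ∈ (Γ.obj d).mSet) (f : c' ⟶ c) {v : Cone D},
    Represents Γ (((Γ.obj d).coneAt h').push ((Γ.obj d).coneAt_vertex h') f) v →
    ∀ (z : D) (y : (Φ.obj c').functor.toFunctor.obj z),
      (Dual.apply (Φ.map f) y).1.1 = v * y.1.1

theorem IsDualOf.unique {Γ : D ⥤ Dual C} (hΓ : IsLocalIso Γ)
    (hcov : ∀ c : C, ∃ d : D, c ∈ (Γ.obj d).mSet) {Φ Φ' : C ⥤ Dual D} (H : IsDualOf Γ Φ)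
    (H' : IsDualOf Γ Φ') (hv : ∀ {c' c : C} {d : D} (h' : c' ∈ (Γ.obj d).mSet) (f : c' ⟶ c),
      ∃ v, Represents Γ (((Γ.obj d).coneAt h').push ((Γ.obj d).coneAt_vertex h') f) v) :
    Φ = Φ' := by
  have e : ∀ c, Φ.obj c = Φ'.obj c := by
    intro c
    obtain ⟨d, h⟩ := hcov c
    obtain ⟨δ, hδ, -, R⟩ := exists_represents hΓ h
    have h₁ := H.obj h hδ R
    have h₂ := H'.obj h hδ R
    refine Dual.ext_mem fun γ => ?_
    rw [← Dual.mem_obj_iff _ (⟨γ, Sub.refl _⟩ : (coneFunctor D).obj γ.vertex),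
      ← Dual.mem_obj_iff _ (⟨γ, Sub.refl _⟩ : (coneFunctor D).obj γ.vertex), h₁, h₂]
  refine Functor.hext e fun c' c f => Dual.heq_of_apply (e _) (e _) _ _ fun z x x' hx => ?_
  obtain ⟨d, h⟩ := hcov c'
  obtain ⟨v, R⟩ := hv h f
  rw [H.map h f R, H'.map h f R, hx]

/-- The action of Φ(f) does not depend on the idempotent over c' used to translate f. On the right
ideal of δ only v · δ and v₀ · δ matter, and they represent the same cone because γ(c',d) ·
(γ(c',d₀) ∗ f°) = γ(c',d) ∗ f°. -/
theorem Represents.mul_eq_of_mem {Γ : D ⥤ Dual C} (hΓ : IsLocalIso Γ) {c' c : C} {d d₀ : D}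
    (h' : c' ∈ (Γ.obj d).mSet) (h₀ : c' ∈ (Γ.obj d₀).mSet) (f : c' ⟶ c) {v v₀ δ y : Cone D}
    (R : Represents Γ (((Γ.obj d).coneAt h').push ((Γ.obj d).coneAt_vertex h') f) v)
    (R₀ : Represents Γ (((Γ.obj d₀).coneAt h₀).push ((Γ.obj d₀).coneAt_vertex h₀) f) v₀)
    (S : Represents Γ ((Γ.obj d).coneAt h') δ) (hy : δ * y = y) : v * y = v₀ * y := by
  have e : v * δ = v₀ * δ := by
    refine Represents.right_unique hΓ (S.mul hΓ R) ?_ (v.mul_sub δ) (v₀.mul_sub δ)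
    have := S.mul hΓ R₀
    rwa [Cone.mul_push_of_vertex (Dual.coneAt_idem _ _) (Dual.coneAt_vertex _ h')] at this ⊢
  rw [← hy, ← mul_assoc, e, mul_assoc]

theorem CrossConnection.isDualOf (Ω : CrossConnection C D) : IsDualOf Ω.Γ Ω.Δ where
  obj {c d} h {δ} hv R := by
    obtain rfl : δ = (Ω.Δ.obj c).coneAt ((Ω.mem_iff c d).1 h) :=
      R.right_unique Ω.localIso_Γ (Ω.represents_coneAt h) (Sub.of_eq hv) (Dual.coneAt_sub _ _)
    exact Dual.coneAt_functor _ _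
  map {c' c d} h' f v R z y := by
    obtain ⟨d', h⟩ := Ω.exists_right c
    obtain ⟨g, hg⟩ := exists_transpose h' h f
    refine ((isTranspose_iff _ _ _ _ _).1 hg z y).trans ?_
    exact Represents.mul_eq_of_mem Ω.localIso_Γ h' h' f ((transpose_iff_represents h' h f g).1 hg)
      R (Ω.represents_coneAt h') ((Dual.mem_iff_coneAt _ _ _).1 (Dual.elt_mem _ y))

theorem CrossConnection.Δ_eq {Ω Ω' : CrossConnection C D} (e : Ω.Γ = Ω'.Γ) : Ω.Δ = Ω'.Δ := by
  refine IsDualOf.unique Ω.localIso_Γ Ω.exists_right Ω.isDualOf (e ▸ Ω'.isDualOf) ?_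
  intro c' c d h' f
  obtain ⟨d', h⟩ := Ω.exists_right c
  obtain ⟨g, hg⟩ := exists_transpose h' h f
  exact ⟨_, (transpose_iff_represents h' h f g).1 hg⟩

end DualFunctor
end CrossConn

namespace CrossConn

/-! ### Existence of the dual functor -/

section DualExists

variable {C D : Type u} [SmallCategory C] [SmallCategory D]
  [CategoryWithSubobjects C] [CategoryWithSubobjects D]
  [ConsistentCategory C] [ConsistentCategory D] {Γ : D ⥤ Dual C}

theorem exists_push_represents (hΓ : IsLocalIso Γ) {c' c : C} {d d' : D}
    (h' : c' ∈ (Γ.obj d).mSet) (h : c ∈ (Γ.obj d').mSet) (f : c' ⟶ c) {δ : Cone D}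
    (hv : δ.vertex = d') (R : Represents Γ ((Γ.obj d').coneAt h) δ) : ∃ g : d' ⟶ d,
      Represents Γ (((Γ.obj d).coneAt h').push ((Γ.obj d).coneAt_vertex h') f) (δ.push hv g) :=
  Represents.exists_push hΓ (Dual.coneAt_idem _ h) hv R
    ((Cone.push_sub _ _ _).trans (Sub.of_eq (Dual.coneAt_vertex _ h).symm))
    ((Dual.mem_iff_coneAt _ h' _).2 (Cone.mul_push (Dual.coneAt_idem _ h') _ f))

theorem exists_isDualOf (hΓ : IsLocalIso Γ) (hcov : ∀ c : C, ∃ d : D, c ∈ (Γ.obj d).mSet) :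
    ∃ Φ : C ⥤ Dual D, IsDualOf Γ Φ := by
  choose d hd using hcov
  choose δ hv hδ R using fun c => exists_represents hΓ (hd c)
  choose g hg using fun (p : Σ c c' : C, c ⟶ c') =>
    exists_push_represents hΓ (hd p.1) (hd p.2.1) p.2.2 (hv p.2.1) (R p.2.1)
  let A : C → Dual D := fun c => ⟨H (δ c), δ c, hδ c, rfl⟩
  have hA : ∀ c γ, (A c).Mem γ ↔ δ c * γ = γ := fun c => Dual.mem_iff _ (hδ c) rfl
  let v : ∀ {c c' : C}, (c ⟶ c') → Cone D := fun {c c'} f => (δ c').push (hv c') (g ⟨c, c', f⟩)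
  have Rv : ∀ {c c' : C} (f : c ⟶ c'), Represents Γ (((Γ.obj (d c)).coneAt (hd c)).push
      ((Γ.obj (d c)).coneAt_vertex (hd c)) f) (v f) := fun f => hg ⟨_, _, f⟩
  have hvs : ∀ {c c' : C} (f : c ⟶ c'), Sub (v f).vertex (d c) := fun f => Cone.push_sub _ _ _
  have hm : ∀ {c c' : C} (f : c ⟶ c') (γ : Cone D), (A c).Mem γ → (A c').Mem (v f * γ) := by
    intro c c' f γ _
    rw [hA, ← mul_assoc, Cone.mul_push (hδ c')]
  let Φ : C ⥤ Dual D :=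
    { obj := A
      map := fun {c c'} f => Dual.mulLeft (A c) (A c') (v f) (hm f)
      map_id := fun c => Dual.hom_ext _ _ fun z y => by
        -- Both functor laws reduce to uniqueness of representing cones: here both sides represent
        -- γ(c,d).
        have e : v (𝟙 c) = δ c := by
          refine Represents.right_unique hΓ (Rv (𝟙 c)) ?_ (hvs _) (Sub.of_eq (hv c))
          rw [Cone.push_id]
          exact R c
        rw [Dual.mulLeft_apply, e, Dual.id_apply]
        exact (hA c _).1 (Dual.elt_mem _ y)
      map_comp := fun {a b c} f f' => Dual.hom_ext _ _ fun z y => by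
        have e : v (f ≫ f') = v f' * v f := by
          refine Represents.right_unique hΓ (Rv _) ?_ (hvs _) (Cone.mul_sub_of _ (hvs f))
          have h := (Rv f).mul hΓ (Rv f')
          rwa [Cone.push_mul _ _ (Cone.push_sub _ _ _), Cone.push_into _ _ (Dual.coneAt_sub _ _),
            Cone.into_vertex (Dual.coneAt_idem _ _) (Dual.coneAt_vertex _ _),
            Category.id_comp] at h
        rw [Dual.mulLeft_apply, Dual.comp_apply, Dual.mulLeft_apply, Dual.mulLeft_apply, e,
          mul_assoc] }
  refine ⟨Φ, ⟨fun {c d'} h {δ'} hv' R' => ?_, fun {c' c d'} h f v' R' z y => ?_⟩⟩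
  -- Independence of the chosen d: two idempotent cones of C with the same vertex c are right
  -- identities for each other. Order reverses under representation, so the two cones of D are left
  -- identities for each other and generate the same right ideal.
  · have e₁ : δ c * δ' = δ' := by
      refine Represents.right_unique hΓ (R'.mul hΓ (R c)) ?_ (Cone.mul_sub _ _) (Sub.refl _)
      rw [Cone.mul_eq_self (Dual.coneAt_idem _ _)]
      · exact R'
      · exact Sub.of_eq ((Dual.coneAt_vertex _ _).trans (Dual.coneAt_vertex _ _).symm)
    have e₂ : δ' * δ c = δ c := by
      refine Represents.right_unique hΓ ((R c).mul hΓ R') ?_ (Cone.mul_sub _ _) (Sub.refl _)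
      rw [Cone.mul_eq_self (Dual.coneAt_idem _ _)]
      · exact R c
      · exact Sub.of_eq ((Dual.coneAt_vertex _ _).trans (Dual.coneAt_vertex _ _).symm)
    have hδ' : IsIdempotentElem δ' := by
      change δ' * δ' = δ'
      rw [← e₁, mul_assoc, ← mul_assoc δ', e₂, ← mul_assoc, hδ c]
    refine Dual.functor_eq_of_mem _ hδ' fun γ => ((hA c γ).trans ⟨fun h => ?_, fun h => ?_⟩)
    · rw [← h, ← mul_assoc, e₂]
    · rw [← h, ← mul_assoc, e₁]
  · change v f * y.1.1 = v' * y.1.1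
    exact Represents.mul_eq_of_mem hΓ (hd c') h f (Rv f) R' (R c')
      ((hA c' _).1 (Dual.elt_mem _ y))

/-! ### A dual functor completes Γ to a cross-connection -/

namespace IsDualOf

variable {Φ : C ⥤ Dual D}

theorem mem_iff (H : IsDualOf Γ Φ) {c : C} {d : D} (h : c ∈ (Γ.obj d).mSet) {δ : Cone D}
    (hδ : IsIdempotentElem δ) (hv : δ.vertex = d) (R : Represents Γ ((Γ.obj d).coneAt h) δ)
    (γ : Cone D) : (Φ.obj c).Mem γ ↔ δ * γ = γ :=
  Dual.mem_iff _ hδ (H.obj h hv R) γ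

/-- Every cone in `Φ(c)` represents left multiplication by a cone with vertex in `c`. -/
theorem exists_represents_of_mem (H : IsDualOf Γ Φ) (hΓ : IsLocalIso Γ)
    (hcov : ∀ c : C, ∃ d : D, c ∈ (Γ.obj d).mSet) {c : C} {w : Cone D} (hw : (Φ.obj c).Mem w) :
    ∃ u : Cone C, Sub u.vertex c ∧ Represents Γ u w := by
  obtain ⟨d, h⟩ := hcov c
  obtain ⟨δ, hv, hδ, R⟩ := exists_represents hΓ h
  rw [H.mem_iff h hδ hv R] at hw
  set g : d ⟶ w.vertex := w.into (Sub.refl _) d with hg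
  let ε := (Γ.obj d).elt ((Γ.obj d).coneAt_mem h) ((Γ.obj d).coneAt_sub h)
  -- Since w = δ ∗ g° for its component g at d, the cone it represents is found by applying Γ(g) to
  -- the generator γ(c,d).
  refine ⟨(Dual.apply (Γ.map g) ε).1.1, (Dual.apply (Γ.map g) ε).1.2,
    Represents.of_into hΓ (Sub.refl _) fun b z x => ?_⟩
  have hx : (Dual.apply (Γ.map (δ.into (Sub.of_eq hv) b)) x).1.1 =
      (Γ.obj d).coneAt h * x.1.1 := R.apply_into hΓ _ _ _
  have hε : (Dual.apply (Γ.map g) ε).1.1 * (Γ.obj d).coneAt h = (Dual.apply (Γ.map g) ε).1.1 :=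
    Cone.mul_eq_self (Dual.coneAt_idem _ h)
      ((Dual.apply (Γ.map g) ε).1.2.trans (Sub.of_eq ((Γ.obj d).coneAt_vertex h).symm))
  rw [Cone.into_eq_of_mul_eq hw (Sub.of_eq hv) (Sub.refl _), Γ.map_comp, Dual.comp_apply, ← hg,
    Dual.apply_eq_mul (Γ.map g) (Dual.coneAt_idem _ h) (Dual.coneAt_functor _ h)
      ((Γ.obj d).coneAt_sub h), hx, ← mul_assoc]
  exact congrArg (· * x.1.1) hε

theorem mem_mSet_iff (H : IsDualOf Γ Φ) (hΓ : IsLocalIso Γ)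
    (hcov : ∀ c : C, ∃ d : D, c ∈ (Γ.obj d).mSet) (c : C) (d : D) :
    c ∈ (Γ.obj d).mSet ↔ d ∈ (Φ.obj c).mSet := by
  constructor
  · intro h
    obtain ⟨δ, hv, hδ, R⟩ := exists_represents hΓ h
    exact Dual.mem_mSet_of_vertex _ hδ hv (H.obj h hv R)
  · intro hd
    obtain ⟨ε, hε, hεv, hA⟩ :
        ∃ ε, IsIdempotentElem ε ∧ ε.vertex = d ∧ (Φ.obj c).functor = CrossConn.H ε :=
      ⟨_, Dual.coneAt_spec _ hd⟩
    subst hεv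
    obtain ⟨u, hu, Ru⟩ := H.exists_represents_of_mem hΓ hcov (Dual.mem_self _ hε hA)
    obtain ⟨hui, huA⟩ := Ru.idem hcov hε
    refine Dual.mem_mSet_of_vertex _ hui (hu.antisymm ?_) huA
    -- It remains to show that the vertex of u, known to lie in c, is all of c. Since ε generates
    -- Φ(c), it fixes δ. Transferring this to C gives γ(c,d₀) · u = γ(c,d₀), and the vertex of the
    -- left side lies in that of u.
    obtain ⟨d₀, h₀⟩ := hcov c
    obtain ⟨δ, hv, hδ, R⟩ := exists_represents hΓ h₀
    have e : ε * δ = δ := (Dual.mem_iff _ hε hA δ).1 ((H.mem_iff h₀ hδ hv R δ).2 hδ)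
    have key : (Γ.obj d₀).coneAt h₀ * u = (Γ.obj d₀).coneAt h₀ :=
      Represents.left_unique hcov (δ := δ) (by rw [← e]; exact R.mul hΓ Ru) R
        (Cone.mul_sub_of _ hu) (Dual.coneAt_sub _ h₀)
    have := Cone.mul_sub ((Γ.obj d₀).coneAt h₀) u
    rw [key] at this
    exact (Sub.of_eq (Dual.coneAt_vertex _ h₀).symm).trans this

theorem isLocalIso (H : IsDualOf Γ Φ) (hΓ : IsLocalIso Γ)
    (hcov : ∀ c : C, ∃ d : D, c ∈ (Γ.obj d).mSet) : IsLocalIso Φ := by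
  have map_incl : ∀ {a b : C} (j : a ⟶ b), IsIncl j → IsIncl (Φ.map j) := by
    intro a b j hj z y
    obtain ⟨d, h⟩ := hcov a
    obtain ⟨δ, hv, hδ, R⟩ := exists_represents hΓ h
    -- Translating by an inclusion leaves γ(a,d) unchanged, so Φ(j) is left multiplication by a
    -- generator of Φ(a) and moves nothing.
    rw [H.map h j (v := δ) (by rwa [Cone.push_incl _ _ hj])]
    exact (H.mem_iff h hδ hv R _).1 (Dual.elt_mem _ y)
  have faithful : Φ.Faithful := by
    refine ⟨fun {c' c} f₁ f₂ e => ?_⟩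
    obtain ⟨d, h'⟩ := hcov c'
    obtain ⟨d', h⟩ := hcov c
    obtain ⟨δ', hv', hδ', R'⟩ := exists_represents hΓ h'
    obtain ⟨δ, hv, hδ, R⟩ := exists_represents hΓ h
    obtain ⟨g₁, R₁⟩ := exists_push_represents hΓ h' h f₁ hv R
    obtain ⟨g₂, R₂⟩ := exists_push_represents hΓ h' h f₂ hv R
    have hm : (Φ.obj c').Mem δ' := (H.mem_iff h' hδ' hv' R' _).2 hδ'
    have e₁ := H.map h' f₁ R₁ _ (Dual.elt _ hm (Sub.refl _))
    rw [e, H.map h' f₂ R₂ _ (Dual.elt _ hm (Sub.refl _))] at e₁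
    have e₂ : δ.push hv g₂ * δ' = δ.push hv g₁ * δ' := e₁
    rw [Cone.mul_eq_self hδ' ((Cone.push_sub _ _ _).trans (Sub.of_eq hv'.symm)),
      Cone.mul_eq_self hδ' ((Cone.push_sub _ _ _).trans (Sub.of_eq hv'.symm))] at e₂
    rw [e₂] at R₂
    exact Cone.push_injective (Dual.coneAt_idem _ h') (Dual.coneAt_vertex _ h')
      (Represents.left_unique hcov R₁ R₂ (Cone.push_sub _ _ _) (Cone.push_sub _ _ _))
  have full : Φ.Full := by
    refine ⟨fun {c' c} τ => ?_⟩
    obtain ⟨d, h'⟩ := hcov c'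
    obtain ⟨δ', hv', hδ', R'⟩ := exists_represents hΓ h'
    have hA := H.obj h' hv' R'
    let y := (Φ.obj c').elt (Dual.mem_self _ hδ' hA) (Sub.of_eq hv')
    set w := (Dual.apply τ y).1.1 with hw
    obtain ⟨u, hu, R⟩ := H.exists_represents_of_mem hΓ hcov (Dual.elt_mem _ (Dual.apply τ y))
    have hwd : w * δ' = w :=
      Cone.mul_eq_self hδ' ((Dual.apply τ y).1.2.trans (Sub.of_eq hv'.symm))
    have e₁ : (Γ.obj d).coneAt h' * u = u :=
      Represents.left_unique hcov (δ := w) (by rw [← hwd]; exact R'.mul hΓ R) R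
        (Cone.mul_sub_of _ hu) hu
    refine ⟨u.into hu c', Dual.hom_ext _ _ fun z x => ?_⟩
    rw [H.map h' (u.into hu c') (v := w) (by rwa [Cone.push_into_eq e₁]),
      Dual.apply_eq_mul τ hδ' hA (Sub.of_eq hv')]
  have mapsub : ∀ {a b : C}, Sub a b → Sub (Φ.obj a) (Φ.obj b) := fun ⟨j, hj⟩ =>
    ⟨Φ.map j, map_incl j hj⟩
  refine IsLocalIso.of_bijOn map_incl full faithful fun c => ⟨fun a ha => mapsub ha, ?_, ?_⟩
  · have key : ∀ {a b : C}, Sub a c → Sub b c → Φ.obj a = Φ.obj b → Sub a b := by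
      intro a b ha hb e
      obtain ⟨i, hi⟩ := Φ.map_surjective (eqToHom e)
      have h₁ : Φ.map (i ≫ hb.hom) = Φ.map ha.hom := by
        refine CategoryWithSubobjects.incl_thin _ _ ?_ (map_incl _ ha.isIncl)
        rw [Φ.map_comp, hi]
        exact CategoryWithSubobjects.incl_comp _ _ (isIncl_eqToHom e) (map_incl _ hb.isIncl)
      refine ⟨i, CategoryWithSubobjects.incl_of_comp i hb.hom hb.isIncl ?_⟩
      rw [Φ.map_injective h₁]
      exact ha.isIncl
    exact fun a ha b hb e => (key ha hb e).antisymm (key hb ha e.symm)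
  · intro B hB
    obtain ⟨δ', hδ', hB'⟩ := B.exists_cone
    obtain ⟨d, h⟩ := hcov c
    obtain ⟨δ, hv, hδ, R⟩ := exists_represents hΓ h
    have e₁ : δ * δ' = δ' := (H.mem_iff h hδ hv R δ').1
      (Dual.sub_iff.1 hB δ' (Dual.mem_self _ hδ' hB'))
    set δ'' := δ' * δ with hδ''
    have e₂ : δ'' * δ' = δ' := by rw [hδ'', mul_assoc, e₁, hδ']
    have hi : IsIdempotentElem δ'' := by
      change δ'' * δ'' = δ''
      conv_lhs => rw [hδ'', ← hδ'', ← mul_assoc, e₂]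
    have e₃ : δ' * δ'' = δ'' := by rw [hδ'', ← mul_assoc, hδ']
    have hm : (Φ.obj c).Mem δ'' := (H.mem_iff h hδ hv R δ'').2 (by rw [hδ'', ← mul_assoc, e₁])
    obtain ⟨u, hu, Ru⟩ := H.exists_represents_of_mem hΓ hcov hm
    obtain ⟨hui, huA⟩ := Ru.idem hcov hi
    have hmem := Dual.mem_mSet_of_vertex _ hui rfl huA
    refine ⟨u.vertex, hu, Dual.ext_mem fun γ => ?_⟩
    rw [H.mem_iff hmem hi rfl (by rwa [← Dual.eq_coneAt _ hmem hui rfl huA]),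
      B.mem_iff hδ' hB']
    constructor
    · intro e
      rw [← e, ← mul_assoc, e₃]
    · intro e
      rw [← e, ← mul_assoc, e₂]

theorem isTranspose_iff (H : IsDualOf Γ Φ) (hΓ : IsLocalIso Γ) {c' c : C} {d d' : D}
    (h' : c' ∈ (Γ.obj d).mSet) (h : c ∈ (Γ.obj d').mSet) (k' : d ∈ (Φ.obj c').mSet)
    (k : d' ∈ (Φ.obj c).mSet) (f : c' ⟶ c) (g : d' ⟶ d) :
    IsTranspose Φ k' k f g ↔
      Represents Γ (((Γ.obj d).coneAt h').push ((Γ.obj d).coneAt_vertex h') f)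
        (((Φ.obj c).coneAt k).push ((Φ.obj c).coneAt_vertex k) g) := by
  obtain ⟨δ, hv, hδ, R⟩ := exists_represents hΓ h
  obtain ⟨δ', hv', hδ', R'⟩ := exists_represents hΓ h'
  have e : δ = (Φ.obj c).coneAt k := Dual.eq_coneAt _ k hδ hv (H.obj h hv R)
  rw [CrossConn.isTranspose_iff, ← Cone.push_congr e hv]
  constructor
  · intro T
    obtain ⟨g₀, R₀⟩ := exists_push_represents hΓ h' h f hv R
    have hm : (Φ.obj c').Mem δ' := (H.mem_iff h' hδ' hv' R' _).2 hδ'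
    have e₁ := T _ (Dual.elt _ hm (Sub.refl _))
    rw [H.map h' f R₀] at e₁
    have e₂ : δ.push hv g₀ * δ' = δ.push hv g * δ' := e₁
    rw [Cone.mul_eq_self hδ' ((Cone.push_sub _ _ _).trans (Sub.of_eq hv'.symm)),
      Cone.mul_eq_self hδ' ((Cone.push_sub _ _ _).trans (Sub.of_eq hv'.symm))] at e₂
    rwa [← e₂]
  · exact fun T => H.map h' f T

/-- A functor dual to `Γ` makes up a cross-connection with `Γ`. -/
theorem exists_crossConnection (H : IsDualOf Γ Φ) (hΓ : IsLocalIso Γ)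
    (hcov : ∀ c : C, ∃ d : D, c ∈ (Γ.obj d).mSet) : ∃ Ω : CrossConnection C D, Ω.Γ = Γ := by
  have hmem := H.mem_mSet_iff hΓ hcov
  have rep : ∀ {c : C} {d : D} (h : c ∈ (Γ.obj d).mSet) (k : d ∈ (Φ.obj c).mSet),
      Represents Γ ((Γ.obj d).coneAt h) ((Φ.obj c).coneAt k) := by
    intro c d h k
    obtain ⟨δ, hv, hδ, R⟩ := exists_represents hΓ h
    rwa [← Dual.eq_coneAt _ k hδ hv (H.obj h hv R)]
  refine ⟨⟨Γ, Φ, hΓ, H.isLocalIso hΓ hcov, hmem, ?_, ?_⟩, rfl⟩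
  · intro c' c d d' h' h f g
    exact (H.isTranspose_iff hΓ h' h _ _ f g).trans (isTranspose_iff_represents hΓ h' h
      (Dual.coneAt_idem _ _) (Dual.coneAt_vertex _ _) (rep h _) f g).symm
  · intro c a d b h h'
    rw [H.isTranspose_iff hΓ h h', Dual.coneAtComponent_eq, Dual.coneAtComponent_eq,
      ← Cone.mul_eq_push, ← Cone.mul_eq_push]
    exact (rep h _).mul hΓ (rep h' _)

end IsDualOf

theorem existsUnique_crossConnection (hΓ : IsLocalIso Γ)
    (hcov : ∀ c : C, ∃ d : D, c ∈ (Γ.obj d).mSet) : ∃! Ω : CrossConnection C D, Ω.Γ = Γ := by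
  obtain ⟨Φ, H⟩ := exists_isDualOf hΓ hcov
  obtain ⟨Ω, rfl⟩ := H.exists_crossConnection hΓ hcov
  exact ⟨Ω, rfl, fun Ω' e => CrossConnection.ext e (CrossConnection.Δ_eq e)⟩

end DualExists
end CrossConn

namespace CrossConn

theorem LCat.ext_carrier {S : Type u} [Semigroup S] {A B : LCat S} (h : A.carrier = B.carrier) :
    A = B := by
  obtain ⟨A, _⟩ := A
  obtain ⟨B, _⟩ := B
  obtain rfl : A = B := h
  rfl

theorem LCat.hom_ext {S : Type u} [Semigroup S] {A B : LCat S} {φ ψ : A ⟶ B}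
    (h : ∀ x : A.carrier, (φ.1 x : S) = ψ.1 x) : φ = ψ :=
  Subtype.ext (funext fun x => Subtype.ext (h x))

theorem LCat.heq_of_apply {S : Type u} [Semigroup S] {A B A' B' : LCat S} (hA : A = A')
    (hB : B = B') (φ : A ⟶ B) (ψ : A' ⟶ B')
    (h : ∀ (x : S) (hx : x ∈ A.carrier) (hx' : x ∈ A'.carrier),
      (φ.1 ⟨x, hx⟩ : S) = ψ.1 ⟨x, hx'⟩) : HEq φ ψ := by
  subst hA hB
  exact heq_of_eq (LCat.hom_ext fun x => h x.1 x.2 x.2)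

theorem exists_eq_mul_iff {S : Type u} [Semigroup S] {e : S} (he : IsIdempotentElem e) (x : S) :
    (∃ s : S, x = s * e) ↔ x * e = x :=
  ⟨fun ⟨s, hs⟩ => by rw [hs, mul_assoc, he.eq], fun h => ⟨x, h.symm⟩⟩

theorem IsRho.apply_eq {S : Type u} [Semigroup S] {A B : LCat S} {φ : A.carrier → B.carrier}
    {e u f : S} (h : IsRho φ e u f) (he : e ∈ A.carrier) (x : A.carrier) :
    (φ x : S) = x * φ ⟨e, he⟩ := by
  obtain ⟨hi, -, hA, -, -, hφ⟩ := h
  have hx : (x : S) * e = x := (exists_eq_mul_iff hi _).1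
    (hA ▸ x.2 : (x : S) ∈ {x | ∃ s, x = s * e})
  rw [hφ, hφ, ← mul_assoc, hx]

namespace CrossConnection

variable {C D : Type u} [SmallCategory C] [SmallCategory D]
  [CategoryWithSubobjects C] [CategoryWithSubobjects D]
  [ConsistentCategory C] [ConsistentCategory D] (Ω : CrossConnection C D)

/-- The semigroup of linked pairs. -/
def linkedSemigroup : Subsemigroup (Cone C × (Cone D)ᵐᵒᵖ) where
  carrier := Ω.linkedPairs
  mul_mem' {p q} hp hq := by
    change Ω.Linked _ _ at hp hq ⊢
    rw [linked_iff] at hp hq ⊢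
    exact hp.mul Ω.localIso_Γ hq

variable {Ω}

theorem linkedSemigroup_represents (s : Ω.linkedSemigroup) :
    Represents Ω.Γ s.1.1 s.1.2.unop := (Ω.linked_iff _ _).1 s.2

/-- The linked pair given by a cone and a cone that represents it. -/
def linkedPair {γ : Cone C} {δ : Cone D} (R : Represents Ω.Γ γ δ) : Ω.linkedSemigroup :=
  ⟨(γ, .op δ), (Ω.linked_iff γ δ).2 R⟩

theorem linkedSemigroup_ext {s t : Ω.linkedSemigroup} (h : s.1.1 = t.1.1) {d : D}
    (hs : Sub s.1.2.unop.vertex d) (ht : Sub t.1.2.unop.vertex d) : s = t := by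
  refine Subtype.ext (Prod.ext h (MulOpposite.unop_injective ?_))
  refine (linkedSemigroup_represents s).right_unique Ω.localIso_Γ ?_ hs ht
  rw [h]
  exact linkedSemigroup_represents t

theorem mul_right_sub (s t : Ω.linkedSemigroup) :
    Sub (s * t).1.2.unop.vertex s.1.2.unop.vertex := Cone.mul_sub t.1.2.unop s.1.2.unop

theorem isIdempotentElem_left {e : Ω.linkedSemigroup} (he : IsIdempotentElem e) :
    IsIdempotentElem e.1.1 := congrArg (fun s : Ω.linkedSemigroup => s.1.1) he.eq

theorem mul_idem_eq_iff {e : Ω.linkedSemigroup} (he : IsIdempotentElem e)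
    (s : Ω.linkedSemigroup) : s * e = s ↔ Sub s.1.1.vertex e.1.1.vertex := by
  have hi := isIdempotentElem_left he
  refine ⟨fun h => h ▸ Cone.mul_sub s.1.1 e.1.1, fun h => ?_⟩
  exact linkedSemigroup_ext (Cone.mul_eq_self hi h) (mul_right_sub s e) (Sub.refl _)

theorem principal_eq {e : Ω.linkedSemigroup} (he : IsIdempotentElem e) :
    {x | ∃ s : Ω.linkedSemigroup, x = s * e} = {x | Sub x.1.1.vertex e.1.1.vertex} := by
  ext x
  exact (exists_eq_mul_iff he x).trans (mul_idem_eq_iff he x)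

/-- The idempotent `(γ(c,d), δ(c,d))`. -/
noncomputable def E.idem {c : C} {d : D} (h : Ω.E c d) : Ω.linkedSemigroup :=
  linkedPair h.represents

theorem E.idem_idem {c : C} {d : D} (h : Ω.E c d) : IsIdempotentElem h.idem :=
  Subtype.ext (Prod.ext h.γ_idem (MulOpposite.unop_injective h.δ_idem))

theorem E.principal_eq {c : C} {d : D} (h : Ω.E c d) :
    {x | ∃ s : Ω.linkedSemigroup, x = s * h.idem} = {x | Sub x.1.1.vertex c} := by
  rw [CrossConnection.principal_eq h.idem_idem]
  change {x : Ω.linkedSemigroup | Sub x.1.1.vertex h.γ.vertex} = _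
  rw [h.γ_vertex]

/-- The linked pair `(γ(c',d) ∗ f°, δ(c,d') ∗ g°)`, where `g` is the transpose of `f`. -/
noncomputable def transposePair {c' c : C} {d d' : D} (h' : Ω.E c' d) (h : Ω.E c d') {f : c' ⟶ c}
    {g : d' ⟶ d} (T : Transpose h' h f g) : Ω.linkedSemigroup :=
  linkedPair ((transpose_iff_represents h' h f g).1 T)

theorem E.mul_pushγ {c c' : C} {d : D} (h : Ω.E c d) (f : c ⟶ c') {γ : Cone C}
    (hγ : Sub γ.vertex c) : γ * h.pushγ f = γ.act (hγ.hom ≫ f) := by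
  have hf : Sub (h.pushγ f).vertex c' := Cone.push_sub _ _ _
  have e : (h.pushγ f).into hf c = f := (Cone.push_into _ _ h.γ_sub f hf c).trans (by
    rw [Cone.into_vertex h.γ_idem h.γ_vertex, Category.id_comp])
  refine Cone.ext_into (γ.mul_sub_of hf) (γ.act_sub _) fun a => ?_
  rw [γ.mul_into _ _ hγ hf, e, γ.act_sub_into]

theorem exists_translate {c c' : C} (f : c ⟶ c') (s : Ω.linkedSemigroup)
    (hs : Sub s.1.1.vertex c) : ∃ t : Ω.linkedSemigroup,
      t.1.1 = s.1.1.act (hs.hom ≫ f) ∧ Sub t.1.2.unop.vertex s.1.2.unop.vertex := by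
  obtain ⟨d, h⟩ := Ω.exists_right c
  obtain ⟨d', h'⟩ := Ω.exists_right c'
  obtain ⟨g, T⟩ := exists_transpose h h' f
  exact ⟨s * transposePair h h' T, h.mul_pushγ f hs, mul_right_sub s _⟩

/-- The image of the linked pair `s` under the map that corresponds to `f`. -/
noncomputable def translate {c c' : C} (f : c ⟶ c') (s : Ω.linkedSemigroup)
    (hs : Sub s.1.1.vertex c) : Ω.linkedSemigroup := (exists_translate f s hs).choose

theorem translate_left {c c' : C} (f : c ⟶ c') (s : Ω.linkedSemigroup)
    (hs : Sub s.1.1.vertex c) : (translate f s hs).1.1 = s.1.1.act (hs.hom ≫ f) :=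
  (exists_translate f s hs).choose_spec.1

theorem translate_right_sub {c c' : C} (f : c ⟶ c') (s : Ω.linkedSemigroup)
    (hs : Sub s.1.1.vertex c) : Sub (translate f s hs).1.2.unop.vertex s.1.2.unop.vertex :=
  (exists_translate f s hs).choose_spec.2

theorem translate_sub {c c' : C} (f : c ⟶ c') (s : Ω.linkedSemigroup)
    (hs : Sub s.1.1.vertex c) : Sub (translate f s hs).1.1.vertex c' := by
  rw [translate_left]
  exact Cone.act_sub _ _

theorem translate_into {c c' : C} (f : c ⟶ c') (s : Ω.linkedSemigroup)
    (hs : Sub s.1.1.vertex c) (a : C) :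
    (translate f s hs).1.1.into (translate_sub f s hs) a = s.1.1.into hs a ≫ f := by
  rw [Cone.into_eq_of_eq (translate_left f s hs) _ (Cone.act_sub _ _), Cone.act_sub_into]

theorem translate_eq_of_into {c c' : C} {f : c ⟶ c'} {s : Ω.linkedSemigroup}
    (hs : Sub s.1.1.vertex c) {t : Ω.linkedSemigroup} (ht : Sub t.1.1.vertex c')
    (h : ∀ a, t.1.1.into ht a = s.1.1.into hs a ≫ f)
    (h' : Sub t.1.2.unop.vertex s.1.2.unop.vertex) : translate f s hs = t :=
  linkedSemigroup_ext (Cone.ext_into (translate_sub f s hs) ht fun a => by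
    rw [translate_into, h]) (translate_right_sub f s hs) h'

theorem translate_eq_mul {c c' : C} {d d' : D} (h : Ω.E c d) (h' : Ω.E c' d') {f : c ⟶ c'}
    {g : d' ⟶ d} (T : Transpose h h' f g) (s : Ω.linkedSemigroup) (hs : Sub s.1.1.vertex c) :
    translate f s hs = s * transposePair h h' T :=
  linkedSemigroup_ext ((translate_left f s hs).trans (h.mul_pushγ f hs).symm)
    (translate_right_sub f s hs) (mul_right_sub s _)

variable (Ω) in
/-- The left ideal of the linked pairs whose first member has its vertex in `c`. -/
def leftObj (c : C) : LCat Ω.linkedSemigroup where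
  carrier := {s | Sub s.1.1.vertex c}
  exists_idem := by
    obtain ⟨d, h⟩ := Ω.exists_right c
    exact ⟨h.idem, h.idem_idem, h.principal_eq.symm⟩

theorem isRho_translate {c c' : C} {d d' : D} (h : Ω.E c d) (h' : Ω.E c' d') {f : c ⟶ c'}
    {g : d' ⟶ d} (T : Transpose h h' f g) :
    IsRho (A := Ω.leftObj c) (B := Ω.leftObj c')
      (fun s => ⟨translate f s.1 s.2, translate_sub f s.1 s.2⟩) h.idem (transposePair h h' T)
      h'.idem := by
  refine ⟨h.idem_idem, h'.idem_idem, h.principal_eq.symm, h'.principal_eq.symm,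
    ⟨transposePair h h' T, ?_⟩, fun s => translate_eq_mul h h' T s.1 s.2⟩
  refine Subtype.ext (Prod.ext ?_ (MulOpposite.unop_injective ?_))
  · change h.pushγ f = h.γ * h.pushγ f * h'.γ
    rw [show h.γ * h.pushγ f = h.pushγ f from Cone.mul_push h.γ_idem h.γ_vertex f]
    exact (Cone.mul_eq_self h'.γ_idem
      ((Cone.push_sub _ _ _).trans (Sub.of_eq h'.γ_vertex.symm))).symm
  · change h'.pushδ g = h'.δ * (h'.pushδ g * h.δ)
    rw [← mul_assoc, show h'.δ * h'.pushδ g = h'.pushδ g from Cone.mul_push h'.δ_idem h'.δ_vertex g]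
    exact (Cone.mul_eq_self h.δ_idem
      ((Cone.push_sub _ _ _).trans (Sub.of_eq h.δ_vertex.symm))).symm

theorem translate_comp {a b c : C} (f : a ⟶ b) (f' : b ⟶ c) (s : Ω.linkedSemigroup)
    (hs : Sub s.1.1.vertex a) :
    translate (f ≫ f') s hs = translate f' (translate f s hs) (translate_sub f s hs) := by
  refine translate_eq_of_into hs (translate_sub f' _ (translate_sub f s hs)) (fun z => ?_)
    ((translate_right_sub f' _ _).trans (translate_right_sub f s hs))
  rw [translate_into, translate_into, Category.assoc]

variable (Ω) in
/-- The functor `F_Ω`. -/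
noncomputable def leftFunctor : C ⥤ LCat Ω.linkedSemigroup where
  obj c := Ω.leftObj c
  map {c c'} f := ⟨fun s => ⟨translate f s.1 s.2, translate_sub f s.1 s.2⟩, by
    obtain ⟨d, h⟩ := Ω.exists_right c
    obtain ⟨d', h'⟩ := Ω.exists_right c'
    obtain ⟨g, T⟩ := exists_transpose h h' f
    exact ⟨_, _, _, isRho_translate h h' T⟩⟩
  map_id c := LCat.hom_ext fun s =>
    translate_eq_of_into s.2 s.2 (fun a => (Category.comp_id _).symm) (Sub.refl _)
  map_comp f f' := LCat.hom_ext fun s => translate_comp f f' s.1 s.2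

theorem isFOmega_leftFunctor : IsFOmega Ω Ω.linkedSemigroup Ω.leftFunctor := by
  refine ⟨fun c d h => ⟨h.idem, rfl, h.idem_idem, h.principal_eq.symm⟩, ?_⟩
  intro c c' d d' h h' f
  obtain ⟨g, T⟩ := exists_transpose h h' f
  exact ⟨g, h.idem, transposePair h h' T, h'.idem, T, rfl, rfl, rfl, isRho_translate h h' T⟩

theorem transpose_unique {c' c : C} {d d' : D} {h' : Ω.E c' d} {h : Ω.E c d'} {f : c' ⟶ c}
    {g₁ g₂ : d' ⟶ d} (T₁ : Transpose h' h f g₁) (T₂ : Transpose h' h f g₂) : g₁ = g₂ := by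
  rw [transpose_iff_represents] at T₁ T₂
  exact Cone.push_injective h.δ_idem h.δ_vertex (T₁.right_unique Ω.localIso_Γ T₂
    (Cone.push_sub _ _ _) (Cone.push_sub _ _ _))

theorem isFOmega_unique {S : Subsemigroup (Cone C × (Cone D)ᵐᵒᵖ)} {F F' : C ⥤ LCat S}
    (h : IsFOmega Ω S F) (h' : IsFOmega Ω S F') : F = F' := by
  have hobj : ∀ c, F.obj c = F'.obj c := by
    intro c
    obtain ⟨d, hc⟩ := Ω.exists_right c
    obtain ⟨e, he, -, hF⟩ := h.1 c d hc
    obtain ⟨e', he', -, hF'⟩ := h'.1 c d hc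
    obtain rfl : e = e' := Subtype.ext (he.trans he'.symm)
    exact LCat.ext_carrier (hF.trans hF'.symm)
  refine Functor.hext hobj fun c c' f =>
    LCat.heq_of_apply (hobj c) (hobj c') _ _ fun x hx hx' => ?_
  obtain ⟨d, hc⟩ := Ω.exists_right c
  obtain ⟨d', hc'⟩ := Ω.exists_right c'
  obtain ⟨g₁, e₁, u₁, e₁', T₁, -, hu₁, -, R₁⟩ := h.2 c c' d d' hc hc' f
  obtain ⟨g₂, e₂, u₂, e₂', T₂, -, hu₂, -, R₂⟩ := h'.2 c c' d d' hc hc' f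
  obtain rfl := transpose_unique T₁ T₂
  obtain rfl : u₁ = u₂ := Subtype.ext (hu₁.trans hu₂.symm)
  rw [R₁.2.2.2.2.2, R₂.2.2.2.2.2]

theorem E.idem_sub {c : C} {d : D} (h : Ω.E c d) : Sub h.idem.1.1.vertex c := h.γ_sub

theorem E.idem_into {c : C} {d : D} (h : Ω.E c d) : h.idem.1.1.into h.idem_sub c = 𝟙 c :=
  Cone.into_vertex h.γ_idem h.γ_vertex _

theorem translate_idem_into {c c' : C} {d : D} (h : Ω.E c d) (f : c ⟶ c') :
    (translate f h.idem h.idem_sub).1.1.into (translate_sub f h.idem h.idem_sub) c = f := by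
  rw [translate_into, h.idem_into, Category.id_comp]

theorem exists_translate_of_isRho {c c' : C}
    (φ : (Ω.leftObj c).carrier → (Ω.leftObj c').carrier) {e u e' : Ω.linkedSemigroup}
    (R : IsRho φ e u e') : ∃ f : c ⟶ c', ∀ (s : Ω.linkedSemigroup) (hs : Sub s.1.1.vertex c),
      translate f s hs = φ ⟨s, hs⟩ := by
  obtain ⟨d, h⟩ := Ω.exists_right c
  have he : e ∈ (Ω.leftObj c).carrier := R.2.2.1 ▸ (exists_eq_mul_iff R.1 e).2 R.1
  obtain ⟨v, hv⟩ : ∃ v, v = φ ⟨h.idem, h.idem_sub⟩ := ⟨_, rfl⟩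
  have hφ : ∀ x : (Ω.leftObj c).carrier, (φ x : Ω.linkedSemigroup) = x * v := by
    intro x
    rw [R.apply_eq he x, hv, R.apply_eq he ⟨h.idem, h.idem_sub⟩, ← mul_assoc,
      (mul_idem_eq_iff h.idem_idem x.1).2 (Sub.trans x.2 (Sub.of_eq h.γ_vertex.symm))]
  have hvs : Sub v.1.1.1.vertex c' := v.2
  refine ⟨v.1.1.1.into hvs c, fun s hs => ?_⟩
  rw [hφ]
  exact translate_eq_of_into hs (Cone.mul_sub_of _ hvs) (fun a => Cone.mul_into _ _ _ hs hvs a)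
    (mul_right_sub _ _)

theorem isCatIso_leftFunctor : IsCatIso Ω.leftFunctor := by
  refine ⟨⟨fun c c' e => ?_, fun A => ?_⟩, fun c c' => ⟨fun f f' e => ?_, fun φ => ?_⟩⟩
  · have key : ∀ {c c' : C}, Ω.leftObj c = Ω.leftObj c' → Sub c c' := by
      intro c c' e
      obtain ⟨d, h⟩ := Ω.exists_right c
      have h₁ : h.idem ∈ (Ω.leftObj c).carrier := h.idem_sub
      rw [e] at h₁
      exact (Sub.of_eq h.γ_vertex.symm).trans h₁
    exact (key e).antisymm (key e.symm)
  · obtain ⟨e, he, hA⟩ := A.exists_idem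
    exact ⟨e.1.1.vertex, LCat.ext_carrier ((principal_eq he).symm.trans hA.symm)⟩
  · obtain ⟨d, h⟩ := Ω.exists_right c
    have h₁ : translate f h.idem h.idem_sub = translate f' h.idem h.idem_sub :=
      congrArg Subtype.val (congrFun (congrArg Subtype.val e) ⟨h.idem, h.idem_sub⟩)
    rw [← translate_idem_into h f, ← translate_idem_into h f']
    exact Cone.into_eq_of_eq (congrArg (fun s => s.1.1) h₁) _ _ _
  · obtain ⟨e, u, e', R⟩ := φ.2
    obtain ⟨f, hf⟩ := exists_translate_of_isRho φ.1 R
    exact ⟨f, LCat.hom_ext fun x => hf x.1 x.2⟩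

theorem isIncl_leftFunctor_map_iff {c c' : C} (f : c ⟶ c') :
    IsIncl (Ω.leftFunctor.map f) ↔ IsIncl f := by
  constructor
  · intro H
    obtain ⟨d, h⟩ := Ω.exists_right c
    have e : translate f h.idem h.idem_sub = h.idem := H ⟨h.idem, h.idem_sub⟩
    have hs : Sub h.idem.1.1.vertex c' := by
      have := translate_sub f h.idem h.idem_sub
      rwa [e] at this
    have hcc : Sub c c' := (Sub.of_eq h.γ_vertex.symm).trans hs
    rw [← translate_idem_into h f, Cone.into_eq_of_eq (congrArg (fun s => s.1.1) e) _ hs,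
      ← Cone.into_comp _ h.idem_sub hs hcc.isIncl, h.idem_into, Category.id_comp]
    exact hcc.isIncl
  · intro hf x
    exact translate_eq_of_into x.2 (Sub.trans x.2 ⟨f, hf⟩)
      (fun a => (Cone.into_comp _ _ _ hf a).symm) (Sub.refl _)

end CrossConnection
end CrossConn

namespace CrossConn

/-! ## Consistency is invariant under isomorphisms -/

section Connection

variable {C : Type u} [SmallCategory C] [CategoryWithSubobjects C]

theorem CoreIdeal.ext_obj {c : C} {a b : CoreIdeal c} (h : a.obj = b.obj) : a = b := by
  obtain ⟨a, _⟩ := a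
  obtain ⟨b, _⟩ := b
  obtain rfl : a = b := h
  rfl

/-- The bimorphism `w` takes the subobject `a` to the subobject `t`, by the morphism `p`. -/
def Restricts {c d : C} (w : c ⟶ d) (a : CoreIdeal c) (t : CoreIdeal d) (p : a.obj ⟶ t.obj) :
    Prop := IsEpiComponent (a.sub.hom ≫ w) p t.sub.hom

/-- The existence of a connecting functor, expressed without functors. -/
structure HasConnection {c d : C} (w : c ⟶ d) : Prop where
  total : ∀ a : CoreIdeal c, ∃ (t : CoreIdeal d) (p : a.obj ⟶ t.obj), Restricts w a t p
  surj : ∀ t : CoreIdeal d, ∃ (a : CoreIdeal c) (p : a.obj ⟶ t.obj), Restricts w a t p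
  inj : ∀ {a a' : CoreIdeal c} {t : CoreIdeal d} {p : a.obj ⟶ t.obj} {p' : a'.obj ⟶ t.obj},
    Restricts w a t p → Restricts w a' t p' → a = a'
  map : ∀ {a a' : CoreIdeal c} {t t' : CoreIdeal d} {p : a.obj ⟶ t.obj} {p' : a'.obj ⟶ t'.obj},
    Restricts w a t p → Restricts w a' t' p' → ∀ f : a ⟶ a',
      ∃ f' : t ⟶ t', f.1 ≫ p' = p ≫ f'.1 ∧ (IsIncl f.1 → IsIncl f'.1)
  lift : ∀ {a a' : CoreIdeal c} {t t' : CoreIdeal d} {p : a.obj ⟶ t.obj} {p' : a'.obj ⟶ t'.obj},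
    Restricts w a t p → Restricts w a' t' p' → ∀ f' : t ⟶ t',
      ∃ f : a ⟶ a', f.1 ≫ p' = p ≫ f'.1

variable (C) in
/-- Factorisations into an epimorphism and an inclusion are unique. -/
def UniqueEpiIncl : Prop := ∀ {a b m n : C} {p : a ⟶ m} {j : m ⟶ b} {p' : a ⟶ n} {j' : n ⟶ b},
  Epi p → Epi p' → IsIncl j → IsIncl j' → p ≫ j = p' ≫ j' → ∃ e : m = n, p ≫ eqToHom e = p'

theorem Restricts.unique (U : UniqueEpiIncl C) {c d : C} {w : c ⟶ d} {a : CoreIdeal c}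
    {t t' : CoreIdeal d} {p : a.obj ⟶ t.obj} {p' : a.obj ⟶ t'.obj} (h : Restricts w a t p)
    (h' : Restricts w a t' p') : ∃ e : t = t', p ≫ eqToHom (congrArg CoreIdeal.obj e) = p' := by
  obtain ⟨e, he⟩ := U h.epi h'.epi h.1 h'.1 (h.2.1.symm.trans h'.2.1)
  exact ⟨CoreIdeal.ext_obj e, he⟩

theorem CoreIdeal.heq_of_comm {d a b : C} {t s t' s' : CoreIdeal d} (et : t = t') (es : s = s')
    (φ : t ⟶ s) (φ' : t' ⟶ s') (f : a ⟶ b) {p : a ⟶ t.obj} {q : b ⟶ s.obj} {p' : a ⟶ t'.obj}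
    {q' : b ⟶ s'.obj} [Epi p] (hp : p ≫ eqToHom (congrArg CoreIdeal.obj et) = p')
    (hq : q ≫ eqToHom (congrArg CoreIdeal.obj es) = q') (h : f ≫ q = p ≫ φ.1)
    (h' : f ≫ q' = p' ≫ φ'.1) : HEq φ φ' := by
  subst et es
  simp only [eqToHom_refl, Category.comp_id] at hp hq
  subst hp hq
  exact heq_of_eq (Subtype.ext ((cancel_epi p).1 (h.symm.trans h')))

theorem IsConnectingFunctor.unique (U : UniqueEpiIncl C) {c d : C} {w : c ⟶ d}
    {T T' : CoreIdeal c ⥤ CoreIdeal d} (h : IsConnectingFunctor w T)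
    (h' : IsConnectingFunctor w T') : T = T' := by
  obtain ⟨-, -, p, hp, hn⟩ := h
  obtain ⟨-, -, p', hp', hn'⟩ := h'
  choose e he using fun a => Restricts.unique U (hp a) (hp' a)
  refine Functor.hext e fun a b f => ?_
  have := (hp a).epi
  exact CoreIdeal.heq_of_comm (e a) (e b) _ _ f.1 (he a) (he b) (hn a b f) (hn' a b f)

theorem IsConnectingFunctor.hasConnection (U : UniqueEpiIncl C) {c d : C} {w : c ⟶ d}
    {T : CoreIdeal c ⥤ CoreIdeal d} (h : IsConnectingFunctor w T) : HasConnection w := by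
  obtain ⟨⟨ho, hm⟩, hi, p, hp, hn⟩ := h
  refine ⟨fun a => ⟨_, p a, hp a⟩, fun t => ?_, ?_, ?_, ?_⟩
  · obtain ⟨a, rfl⟩ := ho.2 t
    exact ⟨a, p a, hp a⟩
  · intro a a' t q q' h h'
    obtain ⟨rfl, -⟩ := Restricts.unique U (hp a) h
    obtain ⟨e, -⟩ := Restricts.unique U (hp a') h'
    exact ho.1 e.symm
  · intro a a' t t' q q' h h' f
    obtain ⟨rfl, rfl⟩ := Restricts.unique U (hp a) h
    obtain ⟨rfl, rfl⟩ := Restricts.unique U (hp a') h'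
    simp only [eqToHom_refl, Category.comp_id]
    exact ⟨T.map f, hn a a' f, hi a a' f⟩
  · intro a a' t t' q q' h h' f'
    obtain ⟨rfl, rfl⟩ := Restricts.unique U (hp a) h
    obtain ⟨rfl, rfl⟩ := Restricts.unique U (hp a') h'
    obtain ⟨f, rfl⟩ := (hm a a').2 f'
    simp only [eqToHom_refl, Category.comp_id]
    exact ⟨f, hn a a' f⟩

theorem HasConnection.existsUnique (U : UniqueEpiIncl C) {c d : C} {w : c ⟶ d} [Mono w]
    (h : HasConnection w) : ∃! T : CoreIdeal c ⥤ CoreIdeal d, IsConnectingFunctor w T := by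
  choose t p hp using h.total
  choose m hm hi using fun (a a' : CoreIdeal c) (f : a ⟶ a') => h.map (hp a) (hp a') f
  have epi : ∀ a, Epi (p a) := fun a => (hp a).epi
  have mono : ∀ a, Mono (p a) := fun a => by
    have : Mono (p a ≫ (t a).sub.hom) := by
      rw [← (hp a).2.1]
      infer_instance
    exact mono_of_mono (p a) (t a).sub.hom
  let T : CoreIdeal c ⥤ CoreIdeal d :=
    { obj := t
      map := fun {a a'} f => m a a' f
      map_id := fun a => Subtype.ext ((cancel_epi (p a)).1 ((hm a a (𝟙 a)).symm.trans
        ((Category.id_comp _).trans (Category.comp_id _).symm)))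
      map_comp := fun {a b e} f g => Subtype.ext ((cancel_epi (p a)).1 (by
        rw [← hm a e (f ≫ g)]
        change (f.1 ≫ g.1) ≫ p e = p a ≫ (m a b f).1 ≫ (m b e g).1
        rw [Category.assoc, hm b e g, ← Category.assoc, hm a b f, Category.assoc])) }
  have key : IsConnectingFunctor w T := by
    refine ⟨⟨⟨fun a a' e => ?_, fun s => ?_⟩, fun a a' => ⟨fun f g e => ?_, fun f' => ?_⟩⟩, hi, p,
      hp, hm⟩
    · have inj : ∀ (s : CoreIdeal d) (p' : a'.obj ⟶ s.obj), Restricts w a' s p' → t a = s →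
          a = a' := by
        rintro s p' h' rfl
        exact h.inj (hp a) h'
      exact inj _ _ (hp a') e
    · obtain ⟨a, q, hq⟩ := h.surj s
      exact ⟨a, (Restricts.unique U (hp a) hq).1⟩
    · have := mono a'
      refine Subtype.ext ((cancel_mono (p a')).1 ?_)
      rw [hm a a' f, hm a a' g]
      exact congrArg (p a ≫ ·) (congrArg Subtype.val e)
    · obtain ⟨f, hf⟩ := h.lift (hp a) (hp a') f'
      exact ⟨f, Subtype.ext ((cancel_epi (p a)).1 ((hm a a' f).symm.trans hf))⟩
  exact ⟨T, key, fun T' h' => h'.unique U key⟩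

end Connection

theorem uniqueEpiIncl (C : Type u) [SmallCategory C] [CategoryWithSubobjects C]
    [ConsistentCategory C] : UniqueEpiIncl C := by
  intro a b m n p j p' j' _ _ hj hj' h
  exact epi_incl_unique hj hj' h

section Transfer

variable {A B : Type u} [SmallCategory A] [SmallCategory B]
  [CategoryWithSubobjects A] [CategoryWithSubobjects B] {F : A ⥤ B}

theorem IsCatIso.isLocalIso (hF : IsCatIso F)
    (hi : ∀ {a b : A} (f : a ⟶ b), IsIncl (F.map f) ↔ IsIncl f) : IsLocalIso F := by
  refine IsLocalIso.of_bijOn (fun j hj => (hi j).2 hj) ⟨fun {a b} => (hF.2 a b).2⟩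
    ⟨fun {a b} => @((hF.2 a b).1)⟩ fun c => ⟨?_, hF.1.1.injOn, ?_⟩
  · rintro a ⟨j, hj⟩
    exact ⟨F.map j, (hi j).2 hj⟩
  · rintro b ⟨j, hj⟩
    obtain ⟨a, rfl⟩ := hF.1.2 b
    obtain ⟨j, rfl⟩ := (hF.2 a c).2 j
    exact ⟨a, ⟨j, (hi j).1 hj⟩, rfl⟩

omit [CategoryWithSubobjects A] [CategoryWithSubobjects B] in
theorem IsCatIso.isEquivalence (hF : IsCatIso F) : F.IsEquivalence where
  faithful := ⟨fun {a b} => @((hF.2 a b).1)⟩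
  full := ⟨fun {a b} => (hF.2 a b).2⟩
  essSurj := ⟨fun b => by
    obtain ⟨a, rfl⟩ := hF.1.2 b
    exact ⟨a, ⟨Iso.refl _⟩⟩⟩

omit [CategoryWithSubobjects A] [CategoryWithSubobjects B] in
theorem IsCatIso.isBimorphism_iff (hF : IsCatIso F) {a b : A} (f : a ⟶ b) :
    IsBimorphism (F.map f) ↔ IsBimorphism f := by
  have := hF.isEquivalence
  rw [IsBimorphism, IsBimorphism, F.mono_map_iff_mono, F.epi_map_iff_epi]

theorem IsCatIso.isRetraction_iff (hF : IsCatIso F)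
    (hi : ∀ {a b : A} (f : a ⟶ b), IsIncl (F.map f) ↔ IsIncl f) {a b : A} (f : a ⟶ b) :
    IsRetraction (F.map f) ↔ IsRetraction f := by
  constructor
  · rintro ⟨j, hj, e⟩
    obtain ⟨j, rfl⟩ := (hF.2 _ _).2 j
    exact ⟨j, (hi j).1 hj, (hF.2 _ _).1 (by rw [F.map_comp, e, F.map_id])⟩
  · rintro ⟨j, hj, e⟩
    exact ⟨F.map j, (hi j).2 hj, by rw [← F.map_comp, e, F.map_id]⟩

theorem IsCatIso.isEpiComponent_iff (hF : IsCatIso F)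
    (hi : ∀ {a b : A} (f : a ⟶ b), IsIncl (F.map f) ↔ IsIncl f) {a b m : A} (f : a ⟶ b)
    (p : a ⟶ m) (j : m ⟶ b) :
    IsEpiComponent (F.map f) (F.map p) (F.map j) ↔ IsEpiComponent f p j := by
  constructor
  · rintro ⟨hj, e, k, q, w, hq, hw, e'⟩
    obtain ⟨k, rfl⟩ := hF.1.2 k
    obtain ⟨q, rfl⟩ := (hF.2 _ _).2 q
    obtain ⟨w, rfl⟩ := (hF.2 _ _).2 w
    exact ⟨(hi j).1 hj, (hF.2 _ _).1 (by rw [e, F.map_comp]), k, q, w,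
      (hF.isRetraction_iff hi q).1 hq, (hF.isBimorphism_iff w).1 hw,
      (hF.2 _ _).1 (by rw [e', F.map_comp])⟩
  · rintro ⟨hj, rfl, k, q, w, hq, hw, rfl⟩
    exact ⟨(hi j).2 hj, F.map_comp _ _, F.obj k, F.map q, F.map w,
      (hF.isRetraction_iff hi q).2 hq, (hF.isBimorphism_iff w).2 hw, F.map_comp _ _⟩

theorem IsCatIso.uniqueEpiIncl (hF : IsCatIso F)
    (hi : ∀ {a b : A} (f : a ⟶ b), IsIncl (F.map f) ↔ IsIncl f) (U : UniqueEpiIncl A) :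
    UniqueEpiIncl B := by
  intro a b m n p j p' j' hp hp' hj hj' e
  have := hF.isEquivalence
  obtain ⟨a, rfl⟩ := hF.1.2 a
  obtain ⟨b, rfl⟩ := hF.1.2 b
  obtain ⟨m, rfl⟩ := hF.1.2 m
  obtain ⟨n, rfl⟩ := hF.1.2 n
  obtain ⟨p, rfl⟩ := (hF.2 _ _).2 p
  obtain ⟨j, rfl⟩ := (hF.2 _ _).2 j
  obtain ⟨p', rfl⟩ := (hF.2 _ _).2 p'
  obtain ⟨j', rfl⟩ := (hF.2 _ _).2 j'
  rw [F.epi_map_iff_epi] at hp hp'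
  obtain ⟨rfl, rfl⟩ := U hp hp' ((hi j).1 hj) ((hi j').1 hj')
    ((hF.2 _ _).1 (by rw [F.map_comp, F.map_comp, e]))
  exact ⟨rfl, by simp⟩

theorem IsCatIso.hasConnection (hF : IsCatIso F)
    (hi : ∀ {a b : A} (f : a ⟶ b), IsIncl (F.map f) ↔ IsIncl f) {c d : A} {w : c ⟶ d}
    (h : HasConnection w) : HasConnection (F.map w) := by
  have hloc := hF.isLocalIso hi
  have sub : ∀ {a b : A}, Sub a b → Sub (F.obj a) (F.obj b) := fun ⟨j, hj⟩ =>
    ⟨F.map j, (hi j).2 hj⟩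
  have shom : ∀ {a b : A} (h : Sub a b) (h' : Sub (F.obj a) (F.obj b)), h'.hom = F.map h.hom :=
    fun h h' => h'.hom_eq ((hi _).2 h.isIncl)
  have lift : ∀ {c : A} (b : CoreIdeal (F.obj c)),
      ∃ a : CoreIdeal c, b = ⟨F.obj a.obj, sub a.sub⟩ := by
    rintro c ⟨b, j, hj⟩
    obtain ⟨a, rfl⟩ := hF.1.2 b
    obtain ⟨j, rfl⟩ := (hF.2 _ _).2 j
    exact ⟨⟨a, j, (hi j).1 hj⟩, rfl⟩
  have res : ∀ {a : CoreIdeal c} {t : CoreIdeal d} (p : a.obj ⟶ t.obj),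
      Restricts (F.map w) ⟨F.obj a.obj, sub a.sub⟩ ⟨F.obj t.obj, sub t.sub⟩ (F.map p) ↔
        Restricts w a t p := by
    intro a t p
    rw [Restricts, Restricts, ← hF.isEpiComponent_iff hi, F.map_comp, ← shom a.sub (sub a.sub),
      ← shom t.sub (sub t.sub)]
  have core : ∀ {c : A} {a b : CoreIdeal c} (f : a.obj ⟶ b.obj),
      Core c f ↔ Core (F.obj c) (F.map f) := fun {c a b} f => hloc.core c f a.sub b.sub
  refine ⟨fun a => ?_, fun t => ?_, ?_, ?_, ?_⟩
  · obtain ⟨a, rfl⟩ := lift a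
    obtain ⟨t, p, hp⟩ := h.total a
    exact ⟨_, _, (res p).2 hp⟩
  · obtain ⟨t, rfl⟩ := lift t
    obtain ⟨a, p, hp⟩ := h.surj t
    exact ⟨_, _, (res p).2 hp⟩
  · intro a a' t p p' hp hp'
    obtain ⟨a, rfl⟩ := lift a
    obtain ⟨a', rfl⟩ := lift a'
    obtain ⟨t, rfl⟩ := lift t
    obtain ⟨p, rfl⟩ := (hF.2 _ _).2 p
    obtain ⟨p', rfl⟩ := (hF.2 _ _).2 p'
    obtain rfl := h.inj ((res p).1 hp) ((res p').1 hp')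
    rfl
  · intro a a' t t' p p' hp hp' f
    obtain ⟨a, rfl⟩ := lift a
    obtain ⟨a', rfl⟩ := lift a'
    obtain ⟨t, rfl⟩ := lift t
    obtain ⟨t', rfl⟩ := lift t'
    obtain ⟨p, rfl⟩ := (hF.2 _ _).2 p
    obtain ⟨p', rfl⟩ := (hF.2 _ _).2 p'
    obtain ⟨f, hf⟩ := f
    obtain ⟨f, rfl⟩ := (hF.2 _ _).2 f
    obtain ⟨f', e, h'⟩ := h.map ((res p).1 hp) ((res p').1 hp') ⟨f, (core f).2 hf⟩
    refine ⟨⟨F.map f'.1, (core f'.1).1 f'.2⟩, ?_, fun H => (hi _).2 (h' ((hi _).1 H))⟩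
    exact (F.map_comp _ _).symm.trans ((congrArg F.map e).trans (F.map_comp _ _))
  · intro a a' t t' p p' hp hp' f
    obtain ⟨a, rfl⟩ := lift a
    obtain ⟨a', rfl⟩ := lift a'
    obtain ⟨t, rfl⟩ := lift t
    obtain ⟨t', rfl⟩ := lift t'
    obtain ⟨p, rfl⟩ := (hF.2 _ _).2 p
    obtain ⟨p', rfl⟩ := (hF.2 _ _).2 p'
    obtain ⟨f, hf⟩ := f
    obtain ⟨f, rfl⟩ := (hF.2 _ _).2 f
    obtain ⟨f', e⟩ := h.lift ((res p).1 hp) ((res p').1 hp') ⟨f, (core f).2 hf⟩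
    exact ⟨⟨F.map f'.1, (core f'.1).1 f'.2⟩,
      (F.map_comp _ _).symm.trans ((congrArg F.map e).trans (F.map_comp _ _))⟩

/-- The image of a consistent cone under an isomorphism. -/
theorem IsCatIso.exists_cone (hF : IsCatIso F)
    (hi : ∀ {a b : A} (f : a ⟶ b), IsIncl (F.map f) ↔ IsIncl f) (ε : Cone A) :
    ∃ (ζ : Cone B) (h : ζ.vertex = F.obj ε.vertex),
      ∀ a, ζ.component (F.obj a) ≫ eqToHom h = F.map (ε.component a) := by
  choose G hG using hF.1.2
  let p : ∀ b, b ⟶ F.obj ε.vertex := fun b => eqToHom (hG b).symm ≫ F.map (ε.component (G b))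
  have hp : ∀ a, p (F.obj a) = F.map (ε.component a) := by
    intro a
    have : ∀ (a' : A) (h : F.obj a' = F.obj a),
        eqToHom h.symm ≫ F.map (ε.component a') = F.map (ε.component a) := by
      intro a' h
      obtain rfl := hF.1.1 h
      simp
    exact this _ (hG _)
  refine ⟨⟨F.obj ε.vertex, p, ?_, ?_⟩, rfl, fun a => ?_⟩
  · intro a b j hj
    obtain ⟨a, rfl⟩ := hF.1.2 a
    obtain ⟨b, rfl⟩ := hF.1.2 b
    obtain ⟨j, rfl⟩ := (hF.2 _ _).2 j
    rw [hp, hp, ← F.map_comp, ε.compat j ((hi j).1 hj)]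
  · obtain ⟨a, ha⟩ := ε.exists_bimorphism
    exact ⟨F.obj a, by rw [hp]; exact (hF.isBimorphism_iff _).2 ha⟩
  · exact (Category.comp_id _).trans (hp a)

/-- Consistency is transferred along isomorphisms that preserve and reflect inclusions. -/
theorem IsCatIso.consistentCategory [ConsistentCategory A] (hF : IsCatIso F)
    (hi : ∀ {a b : A} (f : a ⟶ b), IsIncl (F.map f) ↔ IsIncl f) : ConsistentCategory B where
  split {a b} j hj := by
    obtain ⟨a, rfl⟩ := hF.1.2 a
    obtain ⟨b, rfl⟩ := hF.1.2 b
    obtain ⟨j, rfl⟩ := (hF.2 _ _).2 j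
    obtain ⟨q, hq⟩ := ConsistentCategory.split j ((hi j).1 hj)
    exact ⟨F.map q, by rw [← F.map_comp, hq, F.map_id]⟩
  factor {a b} f := by
    obtain ⟨a, rfl⟩ := hF.1.2 a
    obtain ⟨b, rfl⟩ := hF.1.2 b
    obtain ⟨f, rfl⟩ := (hF.2 _ _).2 f
    obtain ⟨m, p, j, h⟩ := ConsistentCategory.factor f
    exact ⟨_, _, _, (hF.isEpiComponent_iff hi f p j).2 h⟩
  consistent {c d} w hw := by
    refine ⟨hw, ?_⟩
    obtain ⟨c, rfl⟩ := hF.1.2 c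
    obtain ⟨d, rfl⟩ := hF.1.2 d
    obtain ⟨w, rfl⟩ := (hF.2 _ _).2 w
    obtain ⟨T, hT, -⟩ := (ConsistentCategory.consistent w ((hF.isBimorphism_iff w).1 hw)).2
    have := hw.1
    exact (hF.hasConnection hi (hT.hasConnection (CrossConn.uniqueEpiIncl A))).existsUnique
      (hF.uniqueEpiIncl hi (CrossConn.uniqueEpiIncl A))
  normal {a b c} j q hj hq := by
    obtain ⟨a, rfl⟩ := hF.1.2 a
    obtain ⟨b, rfl⟩ := hF.1.2 b
    obtain ⟨c, rfl⟩ := hF.1.2 c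
    obtain ⟨j, rfl⟩ := (hF.2 _ _).2 j
    obtain ⟨q, rfl⟩ := (hF.2 _ _).2 q
    obtain ⟨k, m, r, w, i, hr, hw, h, e⟩ := ConsistentCategory.normal j q ((hi j).1 hj)
      ((hF.isRetraction_iff hi q).1 hq)
    exact ⟨_, _, F.map r, F.map w, F.map i, (hF.isRetraction_iff hi r).2 hr, inferInstance,
      (hi i).2 h, by rw [← F.map_comp, e, F.map_comp, F.map_comp]⟩
  cone c := by
    obtain ⟨c, rfl⟩ := hF.1.2 c
    obtain ⟨ε, rfl, h⟩ := ConsistentCategory.cone c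
    obtain ⟨ζ, e, hζ⟩ := hF.exists_cone hi ε
    refine ⟨ζ, e, (hζ _).trans ?_⟩
    rw [eqToHom_refl, Category.comp_id] at h
    rw [h, F.map_id]

theorem IsCatIso.isConsistentIso [ConsistentCategory A] (hF : IsCatIso F)
    (hi : ∀ {a b : A} (f : a ⟶ b), IsIncl (F.map f) ↔ IsIncl f) : IsConsistentIso F :=
  ⟨inferInstance, hF.consistentCategory hi, hF, hi⟩

end Transfer
end CrossConn

namespace CrossConn

/-! ## Left ideals of the opposite semigroup -/

theorem RCat.ext_carrier {S : Type u} [Semigroup S] {A B : RCat S} (h : A.carrier = B.carrier) :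
    A = B := by
  obtain ⟨A, _⟩ := A
  obtain ⟨B, _⟩ := B
  obtain rfl : A = B := h
  rfl

theorem RCat.hom_ext {S : Type u} [Semigroup S] {A B : RCat S} {φ ψ : A ⟶ B}
    (h : ∀ x : A.carrier, (φ.1 x : S) = ψ.1 x) : φ = ψ :=
  Subtype.ext (funext fun x => Subtype.ext (h x))

theorem RCat.heq_of_apply {S : Type u} [Semigroup S] {A B A' B' : RCat S} (hA : A = A')
    (hB : B = B') (φ : A ⟶ B) (ψ : A' ⟶ B')
    (h : ∀ (x : S) (hx : x ∈ A.carrier) (hx' : x ∈ A'.carrier),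
      (φ.1 ⟨x, hx⟩ : S) = ψ.1 ⟨x, hx'⟩) : HEq φ ψ := by
  subst hA hB
  exact heq_of_eq (RCat.hom_ext fun x => h x.1 x.2 x.2)

section Opposite

variable {S T : Type u} [Semigroup S] [Semigroup T] (θ : S ≃ T)

theorem symm_mul_of_anti (hθ : ∀ x y, θ (x * y) = θ y * θ x) (x y : T) :
    θ.symm (x * y) = θ.symm y * θ.symm x := by
  rw [θ.symm_apply_eq, hθ, θ.apply_symm_apply, θ.apply_symm_apply]

theorem isIdempotentElem_of_anti (hθ : ∀ x y, θ (x * y) = θ y * θ x)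
    {e : S} (he : IsIdempotentElem e) : IsIdempotentElem (θ e) := by
  change θ e * θ e = θ e
  rw [← hθ, he.eq]

theorem preimage_principal_left (hθ : ∀ x y, θ (x * y) = θ y * θ x) (e : S) :
    θ ⁻¹' {x | ∃ s : T, x = s * θ e} = {x | ∃ s : S, x = e * s} := by
  ext x
  constructor
  · rintro ⟨s, hs⟩
    exact ⟨θ.symm s, θ.injective (by rw [hs, hθ, θ.apply_symm_apply])⟩
  · rintro ⟨s, rfl⟩
    exact ⟨θ s, hθ e s⟩

/-- The right ideal of `S` that corresponds to a left ideal of `T`. -/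
def LCat.flip (hθ : ∀ x y, θ (x * y) = θ y * θ x)
    (A : LCat T) : RCat S where
  carrier := θ ⁻¹' A.carrier
  exists_idem := by
    obtain ⟨e, he, hA⟩ := A.exists_idem
    have hs : ∀ x y, θ.symm (x * y) = θ.symm y * θ.symm x := symm_mul_of_anti θ hθ
    refine ⟨θ.symm e, isIdempotentElem_of_anti θ.symm hs he, ?_⟩
    rw [← preimage_principal_left θ hθ, θ.apply_symm_apply, hA]

theorem isLambda_flip (hθ : ∀ x y, θ (x * y) = θ y * θ x)
    {A B : LCat T} {φ : A.carrier → B.carrier} {e u f : S}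
    (h : IsRho φ (θ e) (θ u) (θ f)) :
    IsLambda (A := LCat.flip θ hθ A) (B := LCat.flip θ hθ B)
      (fun x => ⟨θ.symm (φ ⟨θ x.1, x.2⟩), by
        change θ (θ.symm _) ∈ B.carrier
        rw [θ.apply_symm_apply]
        exact (φ _).2⟩) e u f := by
  obtain ⟨he, hf, hA, hB, ⟨s, hs⟩, hφ⟩ := h
  have hi : ∀ {e : S}, IsIdempotentElem (θ e) → IsIdempotentElem e := fun {e} h =>
    θ.injective ((hθ e e).trans h)
  refine ⟨hi he, hi hf, ?_, ?_, ⟨θ.symm s, θ.injective ?_⟩, fun x => ?_⟩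
  · rw [← preimage_principal_left θ hθ, ← hA]
    rfl
  · rw [← preimage_principal_left θ hθ, ← hB]
    rfl
  · rw [hs, hθ, hθ, θ.apply_symm_apply, mul_assoc]
  · refine θ.injective ?_
    rw [θ.apply_symm_apply, hφ, hθ]

/-- An anti-isomorphism from `S` to `T` induces an isomorphism from `𝕃(T)` to `ℝ(S)`. -/
def flipFunctor (hθ : ∀ x y, θ (x * y) = θ y * θ x) : LCat T ⥤ RCat S where
  obj A := LCat.flip θ hθ A
  map {A B} φ := ⟨fun x => ⟨θ.symm (φ.1 ⟨θ x.1, x.2⟩), by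
        change θ (θ.symm _) ∈ B.carrier
        rw [θ.apply_symm_apply]
        exact (φ.1 _).2⟩, by
    obtain ⟨e, u, f, h⟩ := φ.2
    rw [← θ.apply_symm_apply e, ← θ.apply_symm_apply u, ← θ.apply_symm_apply f] at h
    exact ⟨_, _, _, isLambda_flip θ hθ h⟩⟩
  map_id A := RCat.hom_ext fun x => θ.symm_apply_apply _
  map_comp {A B B'} φ ψ := RCat.hom_ext fun x => by
    refine congrArg (fun y => θ.symm (ψ.1 y).1) (Subtype.ext ?_)
    exact (θ.apply_symm_apply _).symm

theorem isCatIso_flipFunctor (hθ : ∀ x y, θ (x * y) = θ y * θ x) : IsCatIso (flipFunctor θ hθ) := by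
  refine ⟨⟨fun A B h => ?_, fun A => ?_⟩, fun A B => ⟨fun φ ψ h => ?_, fun φ => ?_⟩⟩
  · exact LCat.ext_carrier (θ.surjective.preimage_injective (congrArg RCat.carrier h))
  · obtain ⟨e, he, hA⟩ := A.exists_idem
    refine ⟨⟨_, θ e, isIdempotentElem_of_anti θ hθ he, rfl⟩, RCat.ext_carrier ?_⟩
    rw [hA]
    exact preimage_principal_left θ hθ e
  · refine LCat.hom_ext fun x => ?_
    obtain ⟨x, hx⟩ := x
    obtain ⟨y, rfl⟩ := θ.surjective x
    exact θ.symm.injective (congrArg Subtype.val (congrFun (congrArg Subtype.val h) ⟨y, hx⟩))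
  · obtain ⟨e, u, f, he, hf, hA, hB, ⟨s, hs⟩, hφ⟩ := φ.2
    have mem : ∀ {A : LCat T} (x : T), x ∈ A.carrier ↔ θ.symm x ∈ (LCat.flip θ hθ A).carrier := by
      intro A x
      change _ ↔ θ (θ.symm x) ∈ A.carrier
      rw [θ.apply_symm_apply]
    have hc : ∀ {A : LCat T} {e : S}, (LCat.flip θ hθ A).carrier = {x | ∃ s : S, x = e * s} →
        A.carrier = {x | ∃ s : T, x = s * θ e} := by
      intro A e h
      rw [← preimage_principal_left θ hθ] at h
      exact θ.surjective.preimage_injective h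
    refine ⟨⟨fun x => ⟨θ (φ.1 ⟨θ.symm x.1, (mem x.1).1 x.2⟩), (φ.1 _).2⟩, θ e, θ u, θ f,
      isIdempotentElem_of_anti θ hθ he, isIdempotentElem_of_anti θ hθ hf, hc hA, hc hB,
      ⟨θ s, ?_⟩, fun x => ?_⟩, RCat.hom_ext fun x => ?_⟩
    · rw [hs, hθ, hθ, mul_assoc]
    · change θ (φ.1 ⟨θ.symm x.1, _⟩) = _
      rw [hφ, hθ, θ.apply_symm_apply]
    · refine (θ.symm_apply_apply _).trans ?_
      exact congrArg (fun y => (φ.1 y).1) (Subtype.ext (θ.symm_apply_apply x.1))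

theorem isIncl_flipFunctor_map_iff (hθ : ∀ x y, θ (x * y) = θ y * θ x)
    {A B : LCat T} (φ : A ⟶ B) :
    IsIncl ((flipFunctor θ hθ).map φ) ↔ IsIncl φ := by
  constructor
  · rintro h ⟨x, hx⟩
    obtain ⟨y, rfl⟩ := θ.surjective x
    exact (θ.symm_apply_eq.1 (h ⟨y, hx⟩))
  · intro h x
    exact θ.symm_apply_eq.2 (h ⟨θ x.1, x.2⟩)

end Opposite

namespace CrossConnection

variable {C D : Type u} [SmallCategory C] [SmallCategory D]
  [CategoryWithSubobjects C] [CategoryWithSubobjects D]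
  [ConsistentCategory C] [ConsistentCategory D] (Ω : CrossConnection C D)

/-- The cross-connection with the two categories exchanged. -/
def swap : CrossConnection D C where
  Γ := Ω.Δ
  Δ := Ω.Γ
  localIso_Γ := Ω.localIso_Δ
  localIso_Δ := Ω.localIso_Γ
  mem_iff d c := (Ω.mem_iff c d).symm
  transpose_iff h' h f g :=
    (Ω.transpose_iff ((Ω.mem_iff _ _).2 h) ((Ω.mem_iff _ _).2 h') g f).symm
  transpose_component h h' :=
    (Ω.transpose_iff ((Ω.mem_iff _ _).2 h') ((Ω.mem_iff _ _).2 h) _ _).1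
      (Ω.transpose_component ((Ω.mem_iff _ _).2 h') ((Ω.mem_iff _ _).2 h))

variable {Ω}

theorem transpose_swap {c' c : C} {d d' : D} (h' : Ω.E c' d) (h : Ω.E c d') {f : c' ⟶ c}
    {g : d' ⟶ d} : Transpose (Ω := Ω.swap) h.mem h'.mem g f ↔ Transpose h' h f g :=
  (Ω.transpose_iff h' h f g).symm

theorem linked_swap {γ : Cone C} {δ : Cone D} : Ω.swap.Linked δ γ ↔ Ω.Linked γ δ := by
  constructor
  · rintro ⟨d', d, c, c', k', k, g, f, T, rfl, rfl⟩
    exact ⟨c', c, d, d', k.mem, k'.mem, f, g, (transpose_swap (Ω := Ω) k.mem k'.mem).1 T, rfl, rfl⟩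
  · rintro ⟨c', c, d, d', h', h, f, g, T, rfl, rfl⟩
    exact ⟨d', d, c, c', h.mem, h'.mem, g, f, (transpose_swap h' h).2 T, rfl, rfl⟩

variable (Ω) in
/-- The anti-isomorphism that exchanges the members of linked pairs. -/
def swapEquiv : Ω.linkedSemigroup ≃ Ω.swap.linkedSemigroup where
  toFun s := ⟨(s.1.2.unop, .op s.1.1), linked_swap.2 s.2⟩
  invFun s := ⟨(s.1.2.unop, .op s.1.1), linked_swap.1 s.2⟩
  left_inv _ := rfl
  right_inv _ := rfl

theorem swapEquiv_mul (x y : Ω.linkedSemigroup) :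
    Ω.swapEquiv (x * y) = Ω.swapEquiv y * Ω.swapEquiv x := rfl

variable (Ω) in
/-- The functor `G_Ω`. -/
noncomputable def rightFunctor : D ⥤ RCat Ω.linkedSemigroup :=
  Ω.swap.leftFunctor ⋙ flipFunctor Ω.swapEquiv swapEquiv_mul

theorem isGOmega_rightFunctor : IsGOmega Ω Ω.linkedSemigroup Ω.rightFunctor := by
  obtain ⟨hobj, hmap⟩ := isFOmega_leftFunctor (Ω := Ω.swap)
  constructor
  · intro c d h
    obtain ⟨e, he, -, hc⟩ := hobj d c h.mem
    obtain rfl : e = Ω.swapEquiv h.idem := Subtype.ext he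
    refine ⟨h.idem, rfl, h.idem_idem, ?_⟩
    rw [← preimage_principal_left Ω.swapEquiv swapEquiv_mul, ← hc]
    rfl
  · intro c c' d d' h h' g
    obtain ⟨f, e, u, e', T, he, hu, he', R⟩ := hmap d d' c c' h.mem h'.mem g
    obtain ⟨e, rfl⟩ := Ω.swapEquiv.surjective e
    obtain ⟨u, rfl⟩ := Ω.swapEquiv.surjective u
    obtain ⟨e', rfl⟩ := Ω.swapEquiv.surjective e'
    have key : ∀ {s : Ω.linkedSemigroup} {γ : Cone C} {δ : Cone D},
        (Ω.swapEquiv s).1 = (δ, .op γ) → s.1 = (γ, .op δ) := by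
      intro s γ δ h
      exact Prod.ext (MulOpposite.op_injective (congrArg Prod.snd h))
        (MulOpposite.unop_injective (congrArg Prod.fst h))
    exact ⟨f, e, u, e', (transpose_swap h' h).1 T, key he, key hu, key he',
      isLambda_flip Ω.swapEquiv swapEquiv_mul R⟩

theorem isGOmega_unique {S : Subsemigroup (Cone C × (Cone D)ᵐᵒᵖ)} {G G' : D ⥤ RCat S}
    (h : IsGOmega Ω S G) (h' : IsGOmega Ω S G') : G = G' := by
  have hobj : ∀ d, G.obj d = G'.obj d := by
    intro d
    obtain ⟨c, hc⟩ := Ω.exists_left d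
    obtain ⟨e, he, -, hG⟩ := h.1 c d hc
    obtain ⟨e', he', -, hG'⟩ := h'.1 c d hc
    obtain rfl : e = e' := Subtype.ext (he.trans he'.symm)
    exact RCat.ext_carrier (hG.trans hG'.symm)
  refine Functor.hext hobj fun d d' g =>
    RCat.heq_of_apply (hobj d) (hobj d') _ _ fun x hx hx' => ?_
  obtain ⟨c, hc⟩ := Ω.exists_left d
  obtain ⟨c', hc'⟩ := Ω.exists_left d'
  obtain ⟨f₁, e₁, u₁, e₁', T₁, -, hu₁, -, R₁⟩ := h.2 c c' d d' hc hc' g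
  obtain ⟨f₂, e₂, u₂, e₂', T₂, -, hu₂, -, R₂⟩ := h'.2 c c' d d' hc hc' g
  obtain rfl := transpose_unique ((transpose_swap hc' hc).2 T₁) ((transpose_swap hc' hc).2 T₂)
  obtain rfl : u₁ = u₂ := Subtype.ext (hu₁.trans hu₂.symm)
  rw [R₁.2.2.2.2.2, R₂.2.2.2.2.2]

theorem isConsistentIso_leftFunctor : IsConsistentIso Ω.leftFunctor :=
  isCatIso_leftFunctor.isConsistentIso isIncl_leftFunctor_map_iff

theorem isConsistentIso_rightFunctor : IsConsistentIso Ω.rightFunctor := by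
  have h := isCatIso_leftFunctor (Ω := Ω.swap)
  have h' := isCatIso_flipFunctor Ω.swapEquiv swapEquiv_mul
  refine IsCatIso.isConsistentIso ⟨h'.1.comp h.1, fun a b => (h'.2 _ _).comp (h.2 a b)⟩ fun f => ?_
  exact (isIncl_flipFunctor_map_iff Ω.swapEquiv swapEquiv_mul _).trans
    (isIncl_leftFunctor_map_iff f)

end CrossConnection
end CrossConn

theorem mainTheorem6 {C D : Type u} [SmallCategory C] [SmallCategory D]
    [CategoryWithSubobjects C] [CategoryWithSubobjects D]
    [ConsistentCategory C] [ConsistentCategory D] :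
    (∀ Γ : D ⥤ Dual C, IsLocalIso Γ → (∀ c : C, ∃ d : D, c ∈ (Γ.obj d).mSet) →
      ∃! Ω : CrossConnection C D, Ω.Γ = Γ) ∧
    ∀ Ω : CrossConnection C D,
      (∀ c : C, ∃ d : D, Ω.E c d) ∧ (∀ d : D, ∃ c : C, Ω.E c d) ∧
      ∃ S : Subsemigroup (Cone C × (Cone D)ᵐᵒᵖ), (S : Set (Cone C × (Cone D)ᵐᵒᵖ)) = Ω.linkedPairs ∧
        (∃ F : C ⥤ LCat S, IsFOmega Ω S F ∧ (∀ F' : C ⥤ LCat S, IsFOmega Ω S F' → F' = F) ∧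
          IsConsistentIso F) ∧
        ∃ G : D ⥤ RCat S, IsGOmega Ω S G ∧ (∀ G' : D ⥤ RCat S, IsGOmega Ω S G' → G' = G) ∧
          IsConsistentIso G := by
  refine ⟨fun Γ hΓ hcov => existsUnique_crossConnection hΓ hcov, fun Ω =>
    ⟨Ω.exists_right, Ω.exists_left, Ω.linkedSemigroup, rfl, ?_, ?_⟩⟩
  · exact ⟨Ω.leftFunctor, CrossConnection.isFOmega_leftFunctor, fun F' h =>
      CrossConnection.isFOmega_unique h CrossConnection.isFOmega_leftFunctor,
      CrossConnection.isConsistentIso_leftFunctor⟩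
  · exact ⟨Ω.rightFunctor, CrossConnection.isGOmega_rightFunctor, fun G' h =>
      CrossConnection.isGOmega_unique h CrossConnection.isGOmega_rightFunctor,
      CrossConnection.isConsistentIso_rightFunctor⟩
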